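/- All graphs are finite and simple, $\log$ is the binary logarithm, and $\mathbb N=\{0,1,2,\dots\}$. A graph $H$ is a $t$-tree if its vertices have an ordering $v_1,\dots,v_m$ such that, for every $i$, the set $N_H(v_i)\cap\{v_1,\dots,v_{i-1}\}$ is a clique of size at most $t$ in $H$. The strong product $H\boxtimes P$ has vertex set $V(H)\times V(P)$, and two distinct vertices $(a,x)$ and $(b,y)$ are adjacent if and only if ($a=b$ or $ab\in E(H)$) and ($x=y$ or $xy\in E(P)$). A family $\mathcal G$ of graphs has an $f(n)$-bit adjacency labelling scheme if there is a function $A:(\{0,1\}^*)^2\to\{0,1\}$ such that for every $n$ and every $n$-vertex graph $G\in\mathcal G$ there is $\ell:V(G)\to\{0,1\}^*$ such that $|\ell(v)|\le f(n)$ for every $v\in V(G)$ and, for all $v,w\in V(G)$, $A(\ell(v),\ell(w))=1$ if and only if $vw\in E(G)$. Theorem. Let $t\in\mathbb N$ be fixed, and let $\mathcal G_t$ be the family of all graphs that are isomorphic to a subgraph of $H\boxtimes P$ for some $t$-tree $H$ and some path $P$. Then $\mathcal G_t$ has a $(1+o(1))\log n$-bit adjacency labelling scheme, i.e. an $f(n)$-bit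 adjacency labelling scheme for some function $f$ with $f(n)=(1+o(1))\log n$ as $n\to\infty$. More precisely, there is a constant $C>0$, depending only on $t$, such that for every choice of integers $k=k(n)$ (possibly depending on $n$) the family $\mathcal G_t$ has an $f(n)$-bit adjacency labelling scheme for some function $f$ that satisfies $$\bigl|f(n)-\log n\bigr|\le C\,\bigl(k\log\log n+k^{-1}\log n+k\log k\bigr)$$ for every $n$ for which $k=k(n)$ lies in $\bigl\{5,\dots,\bigl\lceil\sqrt{\log n/\log\log n}\,\bigr\rceil\bigr\}$. -/

import Mathlib

open Filter Asymptotics Real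

universe u

namespace AdjacencyLabelling

/-- The strong product `H ⊠ K`: two distinct pairs are adjacent exactly when they are equal or
adjacent in each of the two coordinates. -/
def strongProduct {α β : Type*} (H : SimpleGraph α) (K : SimpleGraph β) :
    SimpleGraph (α × β) where
  Adj x y := x ≠ y ∧ (x.1 = y.1 ∨ H.Adj x.1 y.1) ∧ (x.2 = y.2 ∨ K.Adj x.2 y.2)
  symm := ⟨fun _ _ h => ⟨h.1.symm, h.2.1.imp Eq.symm (fun e => e.symm),
    h.2.2.imp Eq.symm (fun e => e.symm)⟩⟩
  loopless := ⟨fun _ h => h.1 rfl⟩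

/-- A finite graph `H` is a `t`-tree if its vertices can be linearly ordered so that, for every
vertex `v`, the neighbours of `v` that come before `v` form a clique of size at most `t`. -/
def IsTTree {W : Type*} (t : ℕ) (H : SimpleGraph W) : Prop :=
  Finite W ∧ ∃ _ : LinearOrder W, ∀ v : W,
    H.IsClique {u | H.Adj v u ∧ u < v} ∧ {u | H.Adj v u ∧ u < v}.encard ≤ t

/-- A family of graphs. -/
abbrev GraphFamily := ∀ ⦃V : Type u⦄, SimpleGraph V → Prop

/-- The family of the graphs that are (isomorphic to) a subgraph of `H ⊠ P` for some `t`-tree `H`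
and some path `P`. -/
def productSubgraphs (t : ℕ) : GraphFamily.{u} := fun _ G =>
  ∃ (W : Type) (H : SimpleGraph W) (h : ℕ), IsTTree t H ∧
    G.IsContained (strongProduct H (SimpleGraph.pathGraph h))

/-- The family `𝒢` has an `f(n)`-bit adjacency labelling scheme: there is one function `A` of two
bit strings such that the vertices of every `n`-vertex graph `G` of the family can be labelled with
bit strings of length at most `f(n)` from which `A` decides adjacency in `G`. -/
def HasAdjacencyLabellingScheme (𝒢 : GraphFamily.{u}) (f : ℕ → ℝ) : Prop :=
  ∃ A : List Bool → List Bool → Bool, ∀ (V : Type u) [Finite V] (G : SimpleGraph V), 𝒢 G →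
    ∃ ℓ : V → List Bool,
      (∀ v, ((ℓ v).length : ℝ) ≤ f (Nat.card V)) ∧
      ∀ v w, A (ℓ v) (ℓ w) = true ↔ G.Adj v w

end AdjacencyLabelling

namespace AdjacencyLabelling

/-! A vertex of `G` is a point with a row (its path coordinate) and a column (a vertex of `H`). The
fewer than `2 ^ r` columns in use span a part of `H` that lies in an interval graph with at most `(t
+ 1) * r` intervals through each point (`hasIntervals_of_ncard_lt`), and a column and its earlier
neighbours have intervals with a common point `pos`. Two adjacent points lie in rows at distance at
most 1, and one column is among the at most `t + 1` "parents" of the other. So it suffices that a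
label yields, for each parent, an identifier in its own row and in the next one; adjacency is then
decided by comparing identifiers for equality (`ident_inj`, `ident_label`, `identNext_label`).

In row `i` every point has a weight that halves every `k` rows. The weights of all rows add up to at
most `4 * k * n`, so numbering each row by a block about as long as its weight costs `log n + O(k)`
bits. Within a row, a position has one digit per level `0, …, k`: level `l` cuts the line into cells
of weight `2 ^ (l * β)`, and each cell is numbered relative to the next coarser one. A column is
identified by the digits above the coarsest level that separates the ends of its interval, the digit
at that level, and its rank among the intervals through a cut point. The upper digits agree on the
whole interval, so the label of any point inside already contains them; the rest takes `O(β + log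
ω)` further bits.

For the next row, the digits must hardly change. Level `l ≥ 1` therefore uses the weights of a row
that is updated only every `k` rows, and the levels take turns. One step changes the cells of only
one such level, hence at most two of the digits in use, and these are stored. Weights vary by a
factor at most 2 within `k` rows, so digits keep `β + 2` bits (`cell_le_add`, `code_lt`).

Taking `k` and `β` near `√(log n)` gives `log n + O(√(log n))` bits. This one scheme, independent of
the `k` of the theorem, proves both claims, since `√(log n)` is bounded by the stated error term
(`sqrt_logb_le`). -/

/-! ### Self-delimiting messages -/

/-- A self-delimiting encoding of a bit string, followed by the rest of the message. -/
def encBits : List Bool → List Bool → List Bool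
  | [], r => false :: r
  | b :: bs, r => true :: b :: encBits bs r

theorem encBits_inj {bs bs' r r' : List Bool} (h : encBits bs r = encBits bs' r') :
    bs = bs' ∧ r = r' := by
  induction bs generalizing bs' with
  | nil => cases bs' with
    | nil => simpa [encBits] using h
    | cons b' bs' => simp [encBits] at h
  | cons b bs ih => cases bs' with
    | nil => simp [encBits] at h
    | cons b' bs' =>
      simp only [encBits, List.cons.injEq, true_and] at h
      obtain ⟨h1, h2⟩ := ih h.2
      exact ⟨by rw [h.1, h1], h2⟩

theorem length_encBits (bs r : List Bool) :
    (encBits bs r).length = 2 * bs.length + 1 + r.length := by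
  induction bs with
  | nil => simp [encBits]; omega
  | cons b bs ih => simp [encBits, ih]; omega

/-- Encoding of a list of numbers (self-delimiting) followed by one number (in plain binary). -/
def encMessage : List ℕ → ℕ → List Bool
  | [], M => false :: M.bits
  | a :: l, M => true :: encBits a.bits (encMessage l M)

theorem bits_inj {a b : ℕ} (h : a.bits = b.bits) : a = b := by
  induction a using Nat.binaryRec' generalizing b with
  | zero =>
    induction b using Nat.binaryRec' with
    | zero => rfl
    | bit c n hn _ => rw [Nat.bits_append_bit n c hn] at h; simp at h
  | bit c n hn ih =>
    induction b using Nat.binaryRec' with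
    | zero => rw [Nat.bits_append_bit n c hn] at h; simp at h
    | bit c' n' hn' _ =>
      rw [Nat.bits_append_bit n c hn, Nat.bits_append_bit n' c' hn', List.cons.injEq] at h
      rw [h.1, ih h.2]

theorem encMessage_inj {l l' : List ℕ} {M M' : ℕ} (h : encMessage l M = encMessage l' M') :
    l = l' ∧ M = M' := by
  induction l generalizing l' with
  | nil => cases l' with
    | nil =>
      simp only [encMessage, List.cons.injEq, true_and] at h
      exact ⟨rfl, bits_inj h⟩
    | cons b' bs' => simp [encMessage] at h
  | cons b bs ih => cases l' with
    | nil => simp [encMessage] at h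
    | cons b' bs' =>
      simp only [encMessage, List.cons.injEq, true_and] at h
      obtain ⟨h1, h2⟩ := encBits_inj h
      obtain ⟨h3, h4⟩ := ih h2
      exact ⟨by rw [bits_inj h1, h3], h4⟩

theorem length_encMessage_le (l : List ℕ) (M s : ℕ) (hl : ∀ a ∈ l, a < 2 ^ s) :
    (encMessage l M).length ≤ M.size + 1 + l.length * (2 * s + 2) := by
  induction l with
  | nil => simp [encMessage, Nat.size_eq_bits_len]
  | cons a l ih =>
    have h1 := ih fun b hb => hl b (List.mem_cons_of_mem _ hb)
    have h2 : a.bits.length ≤ s := by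
      rw [Nat.size_eq_bits_len]; exact Nat.size_le.2 (hl a (by simp))
    simp only [encMessage, List.length_cons, length_encBits]
    have h3 := Nat.succ_mul l.length (2 * s + 2)
    rw [Nat.succ_eq_add_one] at h3
    omega

/-! ### Numbers with digits of varying width -/

/-- The position at which the `l`-th digit starts, if the `i`-th digit has `b i` bits. -/
def offset (b : ℕ → ℕ) (l : ℕ) : ℕ := ∑ i ∈ Finset.range l, b i

/-- The number with digits `c 0, …, c (n - 1)`. -/
def pack (b c : ℕ → ℕ) (n : ℕ) : ℕ := ∑ l ∈ Finset.range n, 2 ^ offset b l * c l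

/-- The `l`-th digit of `M`. -/
def digit (b : ℕ → ℕ) (M l : ℕ) : ℕ := M / 2 ^ offset b l % 2 ^ b l

theorem pack_lt {b c : ℕ → ℕ} {n : ℕ} (h : ∀ l < n, c l < 2 ^ b l) :
    pack b c n < 2 ^ offset b n := by
  induction n with
  | zero => simp [pack, offset]
  | succ n ih =>
    have h1 := ih fun l hl => h l (by omega)
    have h2 : c n + 1 ≤ 2 ^ b n := h n (by omega)
    simp only [pack, offset, Finset.sum_range_succ, pow_add] at h1 ⊢
    nlinarith [Nat.mul_le_mul_left (2 ^ ∑ i ∈ Finset.range n, b i) h2]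

theorem digit_add_mul {b : ℕ → ℕ} {l n : ℕ} (h : l < n) (M ρ : ℕ) :
    digit b (M + 2 ^ offset b n * ρ) l = digit b M l := by
  obtain ⟨d, rfl⟩ := Nat.exists_eq_add_of_lt h
  have h1 : ∃ e, 2 ^ offset b (l + d + 1) = 2 ^ offset b l * (2 ^ b l * e) := by
    refine ⟨2 ^ ∑ i ∈ Finset.range d, b (l + 1 + i), ?_⟩
    rw [← pow_add, ← pow_add, show l + d + 1 = (l + 1) + d by ring]
    simp only [offset]
    rw [Finset.sum_range_add, Finset.sum_range_succ]
    ring_nf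
  obtain ⟨e, he⟩ := h1
  rw [digit, digit, he, mul_assoc, mul_assoc, Nat.add_mul_div_left _ _ (by positivity),
    Nat.add_mul_mod_self_left]

theorem digit_pack {b c : ℕ → ℕ} {n l : ℕ} (h : ∀ l < n, c l < 2 ^ b l) (hl : l < n) :
    digit b (pack b c n) l = c l := by
  induction n with
  | zero => omega
  | succ n ih =>
    have hp : pack b c (n + 1) = pack b c n + 2 ^ offset b n * c n := by
      simp [pack, Finset.sum_range_succ]
    rw [hp]
    have hlt := pack_lt fun l hl => h l (Nat.lt_succ_of_lt hl)
    rcases Nat.lt_succ_iff_lt_or_eq.1 hl with h1 | rfl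
    · rw [digit_add_mul h1, ih (fun l hl => h l (by omega)) h1]
    · rw [digit, Nat.add_mul_div_left _ _ (by positivity), Nat.div_eq_of_lt hlt, zero_add,
        Nat.mod_eq_of_lt (h l hl)]

/-! ### Interval representations -/

section Intervals

variable {W : Type*} {H : SimpleGraph W}

/-- The subgraph of `H` induced by `U` is contained in an interval graph in which every point lies
in at most `ω` intervals. -/
def HasIntervals (H : SimpleGraph W) (U : Set W) (ω : ℕ) : Prop :=
  ∃ (a b : W → ℕ) (R : ℕ), (∀ u ∈ U, a u ≤ b u ∧ b u < R) ∧
    (∀ u ∈ U, ∀ w ∈ U, H.Adj u w → a u ≤ b w) ∧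
    ∀ y, {u ∈ U | a u ≤ y ∧ y ≤ b u}.ncard ≤ ω

variable [Finite W]

theorem HasIntervals.mono {U U' : Set W} {ω ω' : ℕ} (h : HasIntervals H U ω) (hU : U' ⊆ U)
    (hω : ω ≤ ω') : HasIntervals H U' ω' := by
  obtain ⟨a, b, R, h1, h2, h3⟩ := h
  refine ⟨a, b, R, fun u hu => h1 u (hU hu), fun u hu w hw => h2 u (hU hu) w (hU hw), fun y => ?_⟩
  refine (Set.ncard_le_ncard ?_ (Set.toFinite _)).trans ((h3 y).trans hω)
  exact fun u hu => ⟨hU hu.1, hu.2⟩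

/-- Without edges between the parts, the second representation can be shifted to the right of the
first. -/
theorem HasIntervals.union {A B : Set W} {ω : ℕ} (hA : HasIntervals H A ω)
    (hB : HasIntervals H B ω) (hdis : Disjoint A B)
    (hAB : ∀ u ∈ A, ∀ w ∈ B, ¬ H.Adj u w) : HasIntervals H (A ∪ B) ω := by
  classical
  obtain ⟨a, b, R, h1, h2, h3⟩ := hA
  obtain ⟨a', b', R', h1', h2', h3'⟩ := hB
  have hnB : ∀ u ∈ B, u ∉ A := fun u hu hu' => Set.disjoint_left.1 hdis hu' hu
  refine ⟨fun u => if u ∈ A then a u else R + a' u, fun u => if u ∈ A then b u else R + b' u,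
    R + R', ?_, ?_, fun y => ?_⟩
  · rintro u (hu | hu)
    · have := h1 u hu; simp only [if_pos hu]; omega
    · have := h1' u hu; simp only [if_neg (hnB u hu)]; omega
  · rintro u (hu | hu) w (hw | hw) huw
    · simpa only [if_pos hu, if_pos hw] using h2 u hu w hw huw
    · exact absurd huw (hAB u hu w hw)
    · exact absurd huw.symm (hAB w hw u hu)
    · simpa only [if_neg (hnB u hu), if_neg (hnB w hw), add_le_add_iff_left]
        using h2' u hu w hw huw
  · rcases lt_or_ge y R with hy | hy
    · refine (Set.ncard_le_ncard ?_ (Set.toFinite _)).trans (h3 y)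
      rintro u ⟨hu | hu, h⟩
      · exact ⟨hu, by simpa only [if_pos hu] using h⟩
      · simp only [if_neg (hnB u hu)] at h; omega
    · refine (Set.ncard_le_ncard ?_ (Set.toFinite _)).trans (h3' (y - R))
      rintro u ⟨hu | hu, h⟩
      · have := h1 u hu; simp only [if_pos hu] at h; omega
      · simp only [if_neg (hnB u hu)] at h; exact ⟨hu, by omega⟩

/-- Each vertex of the separator receives an interval covering the whole representation. -/
theorem HasIntervals.union_separator {A S : Set W} {ω s : ℕ} (hA : HasIntervals H A ω)
    (hS : S.ncard ≤ s) : HasIntervals H (A ∪ S) (ω + s) := by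
  classical
  obtain ⟨a, b, R, h1, h2, h3⟩ := hA
  refine ⟨fun u => if u ∈ S then 0 else a u, fun u => if u ∈ S then R else b u,
    R + 1, ?_, ?_, fun y => ?_⟩
  · intro u hu
    by_cases hS : u ∈ S
    · simp [hS]
    · have := h1 u (hu.resolve_right hS); simp only [if_neg hS]; omega
  · intro u hu w hw huw
    by_cases hS : u ∈ S
    · simp [hS]
    · have hu1 := h1 u (hu.resolve_right hS)
      by_cases hS' : w ∈ S
      · simp only [if_neg hS, if_pos hS']; omega
      · simpa only [if_neg hS, if_neg hS'] using
          h2 u (hu.resolve_right hS) w (hw.resolve_right hS') huw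
  · refine (Set.ncard_le_ncard (t := {u ∈ A | a u ≤ y ∧ y ≤ b u} ∪ S) ?_ (Set.toFinite _)).trans
      ((Set.ncard_union_le _ _).trans (add_le_add (h3 y) hS))
    intro u hu
    by_cases hS : u ∈ S
    · exact .inr hS
    · refine .inl ⟨hu.1.resolve_right hS, ?_⟩
      simpa only [if_neg hS] using hu.2

end Intervals

/-! ### The elimination forest of a `t`-tree -/

section TTree

variable {W : Type*} [LinearOrder W] {H : SimpleGraph W}

/-- The neighbours of `v` that come before `v`. -/
def backNbrs (H : SimpleGraph W) (v : W) : Set W := {u | H.Adj v u ∧ u < v}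

/-- `Desc H v w`: the vertex `w` is a descendant of `v` in the elimination forest of `H`, in which
the parent of a vertex is its last earlier neighbour. -/
inductive Desc (H : SimpleGraph W) (v : W) : W → Prop
  | refl : Desc H v v
  | step {p w : W} : Desc H v p → IsGreatest (backNbrs H w) p → Desc H v w

theorem Desc.le {v w : W} (h : Desc H v w) : v ≤ w := by
  induction h with
  | refl => exact le_rfl
  | step _ hp ih => exact ih.trans hp.1.2.le

theorem Desc.trans {u v w : W} (h : Desc H u v) (h' : Desc H v w) : Desc H u w := by
  induction h' with
  | refl => exact h
  | step _ hp ih => exact ih.step hp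

theorem backNbrs_of_isGreatest (hH : ∀ v, H.IsClique (backNbrs H v)) {u p w : W}
    (hu : u ∈ backNbrs H w) (hp : IsGreatest (backNbrs H w) p) : u = p ∨ u ∈ backNbrs H p := by
  rcases eq_or_lt_of_le (hp.2 hu) with h | h
  · exact .inl h
  · exact .inr ⟨hH w hp.1 hu h.ne', h⟩

theorem Desc.backNbrs (hH : ∀ v, H.IsClique (backNbrs H v)) {u v w : W} (h : Desc H v w)
    (hu : u ∈ backNbrs H w) : Desc H v u ∨ u ∈ AdjacencyLabelling.backNbrs H v := by
  induction h with
  | refl => exact .inr hu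
  | step hd hp ih =>
    rcases backNbrs_of_isGreatest hH hu hp with rfl | h
    · exact .inl hd
    · exact ih h

variable [Finite W]

theorem desc_of_mem_backNbrs (hH : ∀ v, H.IsClique (backNbrs H v)) {u w : W}
    (hu : u ∈ backNbrs H w) : Desc H u w := by
  induction w using (Finite.wellFounded_of_trans_of_irrefl ((· < ·) : W → W → Prop)).induction with
  | _ w ih =>
  obtain ⟨p, hp⟩ := (Set.toFinite (backNbrs H w)).exists_maximal ⟨u, hu⟩
  have hp' : IsGreatest (backNbrs H w) p := ⟨hp.1, fun x hx => by
    rcases le_total x p with h | h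
    · exact h
    · exact hp.2 hx h⟩
  rcases backNbrs_of_isGreatest hH hu hp' with rfl | h
  · exact Desc.refl.step hp'
  · exact (ih p hp'.1.2 h).step hp'

/-- A subtree of the elimination forest is attached to the rest only through the earlier neighbours
of its root. -/
theorem not_adj_of_desc (hH : ∀ v, H.IsClique (backNbrs H v)) {c u w : W} (hu : Desc H c u)
    (hw : ¬ Desc H c w) (hwc : w ∉ backNbrs H c) : ¬ H.Adj u w := by
  intro h
  rcases lt_trichotomy u w with h' | rfl | h'
  · exact hw (hu.trans (desc_of_mem_backNbrs hH ⟨h.symm, h'⟩))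
  · exact hw hu
  · rcases hu.backNbrs hH ⟨h, h'⟩ with h1 | h1
    · exact hw h1
    · exact hwc h1

/-- A subtree inside another can be dropped, and one that is not is joined to the remainder by no
edge, so the representations can be placed side by side. -/
theorem hasIntervals_iUnion_desc (hH : ∀ v, H.IsClique (backNbrs H v)) {U : Set W} {ω : ℕ}
    (Y : Finset W) (hY : ∀ c ∈ Y, HasIntervals H (U ∩ {w | Desc H c w}) ω) :
    HasIntervals H (U ∩ {w | ∃ c ∈ Y, Desc H c w}) ω := by
  classical
  induction Y using Finset.induction_on with
  | empty => exact ⟨fun _ => 0, fun _ => 0, 0, by simp, by simp, by simp⟩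
  | insert c Y hc ih =>
    have ih := ih fun d hd => hY d (Finset.mem_insert_of_mem hd)
    by_cases hcY : ∃ d ∈ Y, Desc H d c
    · obtain ⟨d, hd, hdc⟩ := hcY
      refine ih.mono ?_ le_rfl
      rintro w ⟨hw, e, he, hew⟩
      rcases Finset.mem_insert.1 he with rfl | he
      · exact ⟨hw, d, hd, hdc.trans hew⟩
      · exact ⟨hw, e, he, hew⟩
    · refine ((hY c (Finset.mem_insert_self _ _)).union
        (ih.mono (U' := U ∩ {w | (∃ d ∈ Y, Desc H d w) ∧ ¬ Desc H c w})
          (fun w hw => ⟨hw.1, hw.2.1⟩) le_rfl) ?_ ?_).mono ?_ le_rfl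
      · exact Set.disjoint_left.2 fun w hw hw' => hw'.2.2 hw.2
      · rintro u ⟨-, hu⟩ w ⟨-, ⟨d, hd, hdw⟩, hcw⟩
        refine not_adj_of_desc hH hu hcw fun h => hcY ⟨d, hd, ?_⟩
        exact hdw.trans (desc_of_mem_backNbrs hH h)
      · rintro w ⟨hw, e, he, hew⟩
        by_cases h : Desc H c w
        · exact .inl ⟨hw, h⟩
        · rcases Finset.mem_insert.1 he with rfl | he
          · exact absurd hew h
          · exact .inr ⟨hw, ⟨e, he, hew⟩, h⟩

/-- Halving: removing a suitable `v` and its earlier neighbours, at most `t + 1` vertices, leaves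
parts that are covered by the bound for `r`. -/
theorem hasIntervals_of_ncard_lt {t : ℕ} (hH : ∀ v, H.IsClique (backNbrs H v))
    (ht : ∀ v, (backNbrs H v).ncard ≤ t) (r : ℕ) (U : Set W) (hU : U.ncard < 2 ^ r) :
    HasIntervals H U ((t + 1) * r) := by
  classical
  induction r generalizing U with
  | zero =>
    have : U = ∅ := by
      rw [pow_zero, Nat.lt_one_iff, Set.ncard_eq_zero (Set.toFinite _)] at hU; exact hU
    subst this
    exact ⟨fun _ => 0, fun _ => 0, 0, by simp, by simp, by simp⟩
  | succ r ih =>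
    have := Fintype.ofFinite W
    by_cases hbig : ∃ v, 2 ^ r ≤ (U ∩ {w | Desc H v w}).ncard
    · obtain ⟨v, hv, hmax⟩ :=
        (Set.toFinite {v | 2 ^ r ≤ (U ∩ {w | Desc H v w}).ncard}).exists_maximal hbig
      have hgt : HasIntervals H (U ∩ {w | ∃ c ∈ Finset.univ.filter (v < ·), Desc H c w})
          ((t + 1) * r) := by
        refine hasIntervals_iUnion_desc hH _ fun c hc => ih _ ?_
        by_contra hcon
        have hc' : v < c := by simpa using hc
        exact absurd (hmax (not_lt.1 hcon) hc'.le) (not_le.2 hc')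
      have hout : HasIntervals H (U \ {w | Desc H v w}) ((t + 1) * r) := by
        refine ih _ ?_
        have := Set.ncard_inter_add_ncard_sdiff_eq_ncard U {w | Desc H v w} (Set.toFinite _)
        have hv' : 2 ^ r ≤ (U ∩ {w | Desc H v w}).ncard := hv
        rw [pow_succ] at hU
        omega
      have h1 := (hgt.mono (U' := U ∩ {w | Desc H v w ∧ w ≠ v})
        (fun w hw => ⟨hw.1, w, by
          simpa using lt_of_le_of_ne hw.2.1.le hw.2.2.symm, Desc.refl⟩) le_rfl).union
        (hout.mono (U' := {w ∈ U | ¬ Desc H v w ∧ w ∉ backNbrs H v})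
          (fun w hw => ⟨hw.1, hw.2.1⟩) le_rfl)
        (Set.disjoint_left.2 fun w hw hw' => hw'.2.1 hw.2.1)
        (fun u hu w hw => not_adj_of_desc hH hu.2.1 hw.2.1 hw.2.2)
      have hS : (insert v (backNbrs H v)).ncard ≤ t + 1 :=
        (Set.ncard_insert_le _ _).trans (Nat.succ_le_succ (ht v))
      refine (h1.union_separator hS).mono (fun w hw => ?_) (by rw [mul_add_one])
      by_cases h1 : w = v
      · exact .inr (.inl h1)
      by_cases h2 : w ∈ backNbrs H v
      · exact .inr (.inr h2)
      by_cases h3 : Desc H v w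
      · exact .inl (.inl ⟨hw, h3, h1⟩)
      · exact .inl (.inr ⟨hw, h3, h2⟩)
    · push Not at hbig
      refine (hasIntervals_iUnion_desc hH Finset.univ fun c _ => ih _ (hbig c)).mono
        (fun w hw => ⟨hw, w, Finset.mem_univ _, Desc.refl⟩) ?_
      exact Nat.mul_le_mul_left _ (Nat.le_succ r)

end TTree

/-- An interval representation of a part `U` of a `t`-tree, with a linear order of `U` in which each
vertex `v` has a list `par v` of itself and its earlier neighbours, a point `pos v` common to the
intervals of these, and a numbering `rk y` of the intervals through the point `y`. -/
theorem IsTTree.exists_intervals {W : Type*} {t : ℕ} {H : SimpleGraph W} (hH : IsTTree t H)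
    (U : Set W) (r : ℕ) (hU : U.ncard < 2 ^ r) :
    ∃ (a b pos : W → ℕ) (par : W → Fin (t + 1) → W) (rk : ℕ → W → ℕ),
      (∀ v ∈ U, ∀ s, par v s ∈ U ∧ a (par v s) ≤ pos v ∧ pos v ≤ b (par v s)) ∧
      (∀ v, par v 0 = v) ∧
      (∀ u ∈ U, ∀ v ∈ U, H.Adj u v → (∃ s, par u s = v) ∨ ∃ s, par v s = u) ∧
      (∀ y u, u ∈ U → a u ≤ y → y ≤ b u → rk y u < (t + 1) * r) ∧
      ∀ y u u', u ∈ U → u' ∈ U → a u ≤ y → y ≤ b u → a u' ≤ y → y ≤ b u' → rk y u = rk y u' →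
        u = u' := by
  classical
  obtain ⟨hfin, ord, hord⟩ := hH
  have := Fintype.ofFinite W
  have hcl : ∀ v, H.IsClique (backNbrs H v) := fun v => (hord v).1
  have hcard : ∀ v, (backNbrs H v).ncard ≤ t := fun v => by
    have h := (hord v).2
    rw [← Set.Finite.cast_ncard_eq (Set.toFinite _)] at h
    exact_mod_cast h
  obtain ⟨a, b, R, h1, h2, h3⟩ := hasIntervals_of_ncard_lt hcl hcard r U hU
  have hpar : ∀ v, ∃ f : Fin (t + 1) → W, f 0 = v ∧
      Set.range f = insert v (backNbrs H v ∩ U) := fun v => by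
    have hS : (backNbrs H v ∩ U).ncard ≤ t :=
      (Set.ncard_le_ncard Set.inter_subset_left (Set.toFinite _)).trans (hcard v)
    obtain ⟨l, hl, hl'⟩ : ∃ l : List W, (∀ u, u ∈ l ↔ u ∈ backNbrs H v ∩ U) ∧ l.length ≤ t := by
      refine ⟨(backNbrs H v ∩ U).toFinset.toList, by simp, ?_⟩
      rw [Finset.length_toList, ← Set.ncard_eq_toFinset_card']
      exact hS
    -- Unused slots are padded with `v` itself, which leaves the range unchanged.
    refine ⟨fun s => (v :: l).getD s v, by simp, ?_⟩
    ext u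
    simp only [Set.mem_range, Set.mem_insert_iff]
    constructor
    · rintro ⟨s, rfl⟩
      by_cases hs : (s : ℕ) < (v :: l).length
      · rw [List.getD_eq_getElem _ _ hs]
        have := List.getElem_mem hs
        rw [List.mem_cons, hl] at this
        exact this
      · rw [List.getD_eq_default _ _ (not_lt.1 hs)]; exact .inl rfl
    · rintro h
      have : u ∈ v :: l := by rw [List.mem_cons, hl]; exact h
      obtain ⟨i, hi, rfl⟩ := List.getElem_of_mem this
      exact ⟨⟨i, by simp only [List.length_cons] at hi; omega⟩, List.getD_eq_getElem _ _ hi⟩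
  choose par hpar0 hparr using hpar
  have hmem : ∀ v s, par v s = v ∨ par v s ∈ backNbrs H v ∩ U := fun v s => by
    have := Set.mem_range_self (f := par v) s; rw [hparr] at this; exact this
  have hparU : ∀ v ∈ U, ∀ s, par v s ∈ U := fun v hv s => by
    rcases hmem v s with h | h
    · rwa [h]
    · exact h.2
  -- Helly on the line: pairwise intersecting intervals all contain their largest left end. The rank
  -- counts the earlier vertices whose intervals pass through `y`.
  refine ⟨a, b, fun v => Finset.univ.sup fun s => a (par v s), par,
    fun y u => {u' | (u' ∈ U ∧ a u' ≤ y ∧ y ≤ b u') ∧ u' < u}.ncard, ?_, hpar0, ?_, ?_, ?_⟩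
  · intro v hv s
    refine ⟨hparU v hv s, Finset.le_sup (f := fun s => a (par v s)) (Finset.mem_univ s),
      Finset.sup_le fun s' _ => ?_⟩
    by_cases he : par v s' = par v s
    · rw [he]; exact (h1 _ (hparU v hv s)).1
    · refine h2 _ (hparU v hv s') _ (hparU v hv s) ?_
      rcases hmem v s with h | h <;> rcases hmem v s' with h' | h'
      · exact absurd (h'.trans h.symm) he
      · rw [h]; exact h'.1.1.symm
      · rw [h']; exact h.1.1
      · exact hcl v h'.1 h.1 he
  · intro u hu v hv huv
    rcases lt_or_gt_of_ne huv.ne with h | h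
    · right
      have : u ∈ Set.range (par v) := by rw [hparr]; exact .inr ⟨⟨huv.symm, h⟩, hu⟩
      exact this
    · left
      have : v ∈ Set.range (par u) := by rw [hparr]; exact .inr ⟨⟨huv, h⟩, hv⟩
      exact this
  · intro y u hu hy hy'
    refine (Set.ncard_lt_ncard ?_ (Set.toFinite _)).trans_le (h3 y)
    exact ⟨fun x hx => hx.1, fun h => lt_irrefl u (h ⟨hu, hy, hy'⟩).2⟩
  · have key : ∀ y u u', u ∈ U → a u ≤ y → y ≤ b u → u < u' →
        {x | (x ∈ U ∧ a x ≤ y ∧ y ≤ b x) ∧ x < u}.ncard <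
          {x | (x ∈ U ∧ a x ≤ y ∧ y ≤ b x) ∧ x < u'}.ncard := by
      intro y u u' hu hy hy' hlt
      refine Set.ncard_lt_ncard ⟨fun x hx => ⟨hx.1, hx.2.trans hlt⟩, fun h => ?_⟩ (Set.toFinite _)
      exact lt_irrefl u (h ⟨⟨hu, hy, hy'⟩, hlt⟩).2
    intro y u u' hu hu' h1 h2 h3 h4 he
    rcases lt_trichotomy u u' with h | h | h
    · exact absurd he (key y u u' hu h1 h2 h).ne
    · exact h
    · exact absurd he (key y u' u hu' h3 h4 h).ne'

/-! ### Row weights with exponential decay -/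

/-- The weight with which a point in row `j` counts in row `i`. -/
noncomputable def decay (k i j : ℕ) : ℝ := (1 / 2) ^ (Nat.dist i j / k)

theorem decay_pos (k i j : ℕ) : 0 < decay k i j := by unfold decay; positivity

theorem decay_le_one (k i j : ℕ) : decay k i j ≤ 1 :=
  pow_le_one₀ (by norm_num) (by norm_num)

theorem decay_le_two_mul {k i i' : ℕ} (hk : 0 < k) (h : Nat.dist i i' ≤ k) (j : ℕ) :
    decay k i j ≤ 2 * decay k i' j := by
  have h1 : Nat.dist i' j / k ≤ Nat.dist i j / k + 1 := by
    rw [← Nat.add_div_right _ hk]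
    refine Nat.div_le_div_right ?_
    have := Nat.dist.triangle_inequality i' i j
    rw [Nat.dist_comm i' i] at this
    omega
  have h2 : ((1 : ℝ) / 2) ^ (Nat.dist i j / k + 1) ≤ (1 / 2) ^ (Nat.dist i' j / k) :=
    pow_le_pow_of_le_one (by norm_num) (by norm_num) h1
  rw [pow_succ] at h2
  unfold decay
  linarith

/-- The summand is constant on blocks of length `k`, which leaves `k` times a geometric series. -/
theorem sum_half_pow_div_le {k : ℕ} (hk : 0 < k) (D : ℕ) :
    ∑ d ∈ Finset.range D, ((1 : ℝ) / 2) ^ (d / k) ≤ 2 * k := by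
  have h1 : ∀ m : ℕ, ∑ d ∈ Finset.range (k * m), ((1 : ℝ) / 2) ^ (d / k) =
      k * (2 - 2 * (1 / 2) ^ m) := by
    intro m
    induction m with
    | zero => simp
    | succ m ih =>
      rw [mul_add_one, Finset.sum_range_add, ih]
      have : ∀ d ∈ Finset.range k, ((1 : ℝ) / 2) ^ ((k * m + d) / k) = (1 / 2) ^ m := by
        intro d hd
        rw [Nat.mul_add_div hk, Nat.div_eq_of_lt (Finset.mem_range.1 hd), add_zero]
      rw [Finset.sum_congr rfl this, Finset.sum_const, Finset.card_range, nsmul_eq_mul, pow_succ]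
      ring
  calc ∑ d ∈ Finset.range D, ((1 : ℝ) / 2) ^ (d / k)
      ≤ ∑ d ∈ Finset.range (k * D), ((1 : ℝ) / 2) ^ (d / k) :=
        Finset.sum_le_sum_of_subset_of_nonneg
          (Finset.range_mono (Nat.le_mul_of_pos_left D hk)) fun _ _ _ => by positivity
    _ = k * (2 - 2 * (1 / 2) ^ D) := h1 D
    _ ≤ k * 2 := by gcongr; linarith [show (0 : ℝ) ≤ (1 / 2) ^ D by positivity]
    _ = 2 * k := mul_comm _ _

theorem sum_decay_le {k : ℕ} (hk : 0 < k) (h j : ℕ) :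
    ∑ i ∈ Finset.range h, decay k i j ≤ 4 * k := by
  have h1 : ∑ i ∈ Finset.range j, decay k i j ≤ 2 * k := by
    refine le_trans ?_ (sum_half_pow_div_le hk j)
    rw [← Finset.sum_range_reflect]
    refine Finset.sum_le_sum fun i hi => ?_
    refine pow_le_pow_of_le_one (by norm_num) (by norm_num) (Nat.div_le_div_right ?_)
    rw [Finset.mem_range] at hi
    simp only [Nat.dist]; omega
  have h2 : ∑ i ∈ Finset.range h, decay k (j + i) j ≤ 2 * k := by
    refine le_trans (Finset.sum_le_sum fun i hi => ?_) (sum_half_pow_div_le hk h)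
    refine pow_le_pow_of_le_one (by norm_num) (by norm_num) (Nat.div_le_div_right ?_)
    simp only [Nat.dist]; omega
  calc ∑ i ∈ Finset.range h, decay k i j ≤ ∑ i ∈ Finset.range (j + h), decay k i j :=
        Finset.sum_le_sum_of_subset_of_nonneg (Finset.range_mono (Nat.le_add_left _ _))
          fun _ _ _ => (decay_pos _ _ _).le
    _ ≤ 4 * k := by rw [Finset.sum_range_add]; linarith

/-! ### Layouts and the update schedule -/

/-- A finite set `V` of points in rows and columns, where each column `u` has a position `pos u` on
a line, an interval `[a u, b u]` and a list `par u` of columns (its parents and itself) whose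
intervals contain `pos u`; `rk y` numbers the intervals that contain `y`. The numbers `k` and `β`
are the number of levels and the number of bits for each level in the labels to be built. -/
structure Layout (V W : Type*) [Fintype V] (t : ℕ) where
  (row : V → ℕ) (col : V → W) (pos a b : W → ℕ) (par : W → Fin (t + 1) → W) (rk : ℕ → W → ℕ)
  (k β ω : ℕ)
  two_le : 2 ≤ k
  card_le : Fintype.card V ≤ 2 ^ ((k + 1) * β)
  par_zero : ∀ u, par u 0 = u
  par_mem : ∀ z s, par (col z) s ∈ Set.range col
  le_pos : ∀ z s, a (par (col z) s) ≤ pos (col z)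
  pos_le : ∀ z s, pos (col z) ≤ b (par (col z) s)
  rk_lt : ∀ y u, u ∈ Set.range col → a u ≤ y → y ≤ b u → rk y u < ω
  rk_inj : ∀ y u u', u ∈ Set.range col → u' ∈ Set.range col → a u ≤ y → y ≤ b u → a u' ≤ y →
    y ≤ b u' → rk y u = rk y u' → u = u'

/-- The last time, up to `i` or slightly later, at which level `l` is updated. -/
def updateTime (k l i : ℕ) : ℕ := if l = 0 then i else k * ((i + l) / k)

theorem dist_updateTime_le {k l : ℕ} (hk : 0 < k) (hl : l ≤ k) (i : ℕ) :
    Nat.dist (updateTime k l i) i ≤ k := by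
  unfold updateTime
  split_ifs
  · simp
  · have h1 := Nat.div_add_mod (i + l) k
    have h2 := Nat.mod_lt (i + l) hk
    simp only [Nat.dist]; omega

/-- Neighbouring levels thus use weights that agree up to a factor 2. -/
theorem dist_updateTime_succ_le {k l : ℕ} (hk : 0 < k) (hl : l + 1 ≤ k) (i : ℕ) :
    Nat.dist (updateTime k l i) (updateTime k (l + 1) i) ≤ k := by
  rcases Nat.eq_zero_or_pos l with rfl | h0
  · rw [Nat.dist_comm]; exact dist_updateTime_le hk hl i
  · unfold updateTime
    rw [if_neg (by omega), if_neg (by omega)]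
    have h1 : (i + l) / k ≤ (i + (l + 1)) / k := Nat.div_le_div_right (by omega)
    have h2 : (i + (l + 1)) / k ≤ (i + l) / k + 1 := by
      rw [← Nat.add_div_right _ hk]; exact Nat.div_le_div_right (by omega)
    have h3 := Nat.mul_le_mul_left k h1
    have h4 := Nat.mul_le_mul_left k h2
    rw [mul_add_one] at h4
    simp only [Nat.dist]; omega

theorem updateTime_succ {k l i : ℕ} (hl : l ≠ 0) (h : ¬ k ∣ i + 1 + l) :
    updateTime k l (i + 1) = updateTime k l i := by
  unfold updateTime
  rw [if_neg hl, if_neg hl, show i + 1 + l = i + l + 1 by ring, Nat.succ_div,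
    if_neg (by rwa [show i + l + 1 = i + 1 + l by ring]), add_zero]

/-- The number of bits for the digit of level `l` in a row of weight at most `2 ^ L`. -/
def bits (β L l : ℕ) : ℕ := min β (L - l * β) + 2

/-- The variable parts telescope to `min L (n * β)`; only the 2 spare bits per level exceed the
logarithm of the weight. -/
theorem offset_bits_le (β L n : ℕ) : offset (bits β L) n ≤ L + 2 * n := by
  have : offset (bits β L) n = min L (n * β) + 2 * n := by
    induction n with
    | zero => simp [offset]
    | succ n ih =>
      have : offset (bits β L) (n + 1) = offset (bits β L) n + bits β L n := by
        simp [offset, Finset.sum_range_succ]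
      rw [this, ih, bits, add_one_mul]
      omega
  omega

/-! ### Cells and codes within a row -/

namespace Layout

variable {V W : Type*} [Fintype V] {t : ℕ} (Y : Layout V W t)

theorem k_pos : 0 < Y.k := by have := Y.two_le; omega

/-- The weight in row `i` of all points. -/
noncomputable def total (i : ℕ) : ℝ := ∑ z, decay Y.k i (Y.row z)

/-- The weight in row `i` of the points at positions smaller than `y`. -/
noncomputable def cumul (i y : ℕ) : ℝ :=
  ∑ z, if Y.pos (Y.col z) < y then decay Y.k i (Y.row z) else 0

theorem total_le_card (i : ℕ) : Y.total i ≤ Fintype.card V := by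
  refine (Finset.sum_le_card_nsmul _ _ 1 fun z _ => decay_le_one _ _ _).trans ?_
  simp

theorem total_le_two_mul {i i' : ℕ} (h : Nat.dist i i' ≤ Y.k) :
    Y.total i ≤ 2 * Y.total i' := by
  rw [total, total, Finset.mul_sum]
  exact Finset.sum_le_sum fun z _ => decay_le_two_mul Y.k_pos h _

theorem cumul_nonneg (i y : ℕ) : 0 ≤ Y.cumul i y :=
  Finset.sum_nonneg fun z _ => by split_ifs; exacts [(decay_pos _ _ _).le, le_rfl]

theorem cumul_le_total (i y : ℕ) : Y.cumul i y ≤ Y.total i :=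
  Finset.sum_le_sum fun z _ => by split_ifs; exacts [le_rfl, (decay_pos _ _ _).le]

theorem cumul_sub {i y y' : ℕ} (h : y ≤ y') : Y.cumul i y' - Y.cumul i y =
    ∑ z, if y ≤ Y.pos (Y.col z) ∧ Y.pos (Y.col z) < y' then decay Y.k i (Y.row z) else 0 := by
  rw [cumul, cumul, ← Finset.sum_sub_distrib]
  refine Finset.sum_congr rfl fun z _ => ?_
  rcases lt_or_ge (Y.pos (Y.col z)) y with h1 | h1
  · rw [if_pos (h1.trans_le h), if_pos h1, if_neg (by omega), sub_self]
  · rw [if_neg (not_lt.2 h1), sub_zero]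
    simp only [h1, true_and]

theorem cumul_mono (i : ℕ) : Monotone (Y.cumul i) := fun y y' h => by
  rw [← sub_nonneg, Y.cumul_sub h]
  exact Finset.sum_nonneg fun z _ => by split_ifs; exacts [(decay_pos _ _ _).le, le_rfl]

theorem cumul_sub_le {i i' y y' : ℕ} (hi : Nat.dist i i' ≤ Y.k) (h : y ≤ y') :
    Y.cumul i y' - Y.cumul i y ≤ 2 * (Y.cumul i' y' - Y.cumul i' y) := by
  rw [Y.cumul_sub h, Y.cumul_sub h, Finset.mul_sum]
  refine Finset.sum_le_sum fun z _ => ?_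
  split_ifs
  · exact decay_le_two_mul Y.k_pos hi _
  · simp

theorem decay_eq_one {i : ℕ} {z : V} (h : Y.row z = i ∨ Y.row z + 1 = i) :
    decay Y.k i (Y.row z) = 1 := by
  have h1 : Nat.dist i (Y.row z) / Y.k = 0 := by
    refine Nat.div_eq_of_lt ?_
    have := Y.two_le
    simp only [Nat.dist]; omega
  rw [decay, h1, pow_zero]

/-- Points of row `i` and of the row before have full weight 1 in row `i`, so level 0 separates the
two sides of such a point. -/
theorem one_le_cumul_sub {i y y' : ℕ} {z : V} (h : Y.row z = i ∨ Y.row z + 1 = i)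
    (hy : y ≤ Y.pos (Y.col z)) (hy' : Y.pos (Y.col z) < y') :
    1 ≤ Y.cumul i y' - Y.cumul i y := by
  rw [Y.cumul_sub (hy.trans hy'.le)]
  refine le_trans ?_ (Finset.single_le_sum
    (f := fun z => if y ≤ Y.pos (Y.col z) ∧ Y.pos (Y.col z) < y' then
      decay Y.k i (Y.row z) else 0)
    (fun z _ => by split_ifs; exacts [(decay_pos _ _ _).le, le_rfl])
    (Finset.mem_univ z))
  simp only [if_pos (And.intro hy hy'), Y.decay_eq_one h, le_refl]

theorem one_le_total {i : ℕ} {z : V} (h : Y.row z = i ∨ Y.row z + 1 = i) : 1 ≤ Y.total i := by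
  rw [← Y.decay_eq_one h]
  exact Finset.single_le_sum (f := fun z => decay Y.k i (Y.row z))
    (fun z _ => (decay_pos _ _ _).le) (Finset.mem_univ z)

theorem sum_total_le (h : ℕ) :
    ∑ i ∈ Finset.range h, Y.total i ≤ 4 * Y.k * Fintype.card V := by
  unfold total
  rw [Finset.sum_comm]
  refine (Finset.sum_le_card_nsmul _ _ (4 * (Y.k : ℝ)) fun z _ => sum_decay_le Y.k_pos h _).trans ?_
  rw [nsmul_eq_mul, mul_comm, Finset.card_univ]

/-- The cell of level `l` that contains the position `y` in row `i`. -/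
noncomputable def cell (l i y : ℕ) : ℕ :=
  if l ≤ Y.k then ⌊Y.cumul (updateTime Y.k l i) y / 2 ^ (l * Y.β)⌋₊ else 0

theorem cell_mono (l i : ℕ) : Monotone (Y.cell l i) := fun y y' h => by
  unfold cell
  split_ifs
  · exact Nat.floor_le_floor (by gcongr; exact Y.cumul_mono _ h)
  · exact le_rfl

theorem cell_top {l : ℕ} (hl : Y.k < l) (i y : ℕ) : Y.cell l i y = 0 := if_neg (by omega)

theorem cell_le (l i y : ℕ) : (Y.cell l i y : ℝ) ≤ 2 * Y.total i / 2 ^ (l * Y.β) := by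
  unfold cell
  split_ifs with hl
  · refine (Nat.floor_le (div_nonneg (Y.cumul_nonneg _ _) (by positivity))).trans ?_
    gcongr
    exact (Y.cumul_le_total _ _).trans
      (Y.total_le_two_mul (dist_updateTime_le Y.k_pos hl i))
  · have : 0 ≤ Y.total i := Finset.sum_nonneg fun z _ => (decay_pos _ _ _).le
    simp only [Nat.cast_zero]; positivity

/-- A common cell of level `l + 1` bounds the weight between the positions by `2 ^ ((l + 1) * β)` at
the update time of that level, hence by twice this at the time of level `l`. -/
theorem cell_le_add {l i y y' : ℕ} (hl : l + 1 ≤ Y.k)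
    (h : Y.cell (l + 1) i y = Y.cell (l + 1) i y') : Y.cell l i y' ≤ Y.cell l i y + 2 * 2 ^ Y.β := by
  rcases le_total y' y with hy | hy
  · exact (Y.cell_mono l i hy).trans (Nat.le_add_right _ _)
  unfold cell at h ⊢
  rw [if_pos hl, if_pos hl] at h
  rw [if_pos (by omega), if_pos (by omega)]
  set A := Y.cumul (updateTime Y.k (l + 1) i)
  set B := Y.cumul (updateTime Y.k l i)
  have hA : 0 ≤ A y' / 2 ^ ((l + 1) * Y.β) := div_nonneg (Y.cumul_nonneg _ _) (by positivity)
  have hB : 0 ≤ B y / 2 ^ (l * Y.β) := div_nonneg (Y.cumul_nonneg _ _) (by positivity)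
  have hA0 : 0 ≤ A y / 2 ^ ((l + 1) * Y.β) := div_nonneg (Y.cumul_nonneg _ _) (by positivity)
  have h1 : A y' / 2 ^ ((l + 1) * Y.β) < A y / 2 ^ ((l + 1) * Y.β) + 1 := by
    have h1 := Nat.lt_floor_add_one (A y' / 2 ^ ((l + 1) * Y.β))
    rw [← h] at h1
    linarith [Nat.floor_le hA0]
  have h2 : B y' - B y ≤ 2 * (A y' - A y) :=
    Y.cumul_sub_le (dist_updateTime_succ_le Y.k_pos hl i) hy
  rw [← sub_lt_iff_lt_add', ← sub_div, div_lt_one (by positivity), add_one_mul, pow_add] at h1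
  have h3 : B y' / 2 ^ (l * Y.β) ≤ B y / 2 ^ (l * Y.β) + 2 * 2 ^ Y.β := by
    rw [← sub_le_iff_le_add', ← sub_div, div_le_iff₀ (by positivity)]
    nlinarith
  have h4 : B y / 2 ^ (l * Y.β) + 2 * 2 ^ Y.β =
      B y / 2 ^ (l * Y.β) + ((2 * 2 ^ Y.β : ℕ) : ℝ) := by push_cast; ring
  rw [h4] at h3
  exact (Nat.floor_le_floor h3).trans (Nat.floor_add_natCast hB _).le

/-- The first cell of level `l` that meets the cell `m` of level `l + 1`. -/
noncomputable def cellBase (l i m : ℕ) : ℕ := sInf (Y.cell l i '' {y | Y.cell (l + 1) i y = m})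

/-- The cell of level `l` that contains `y`, relative to the cell of level `l + 1`. -/
noncomputable def code (l i y : ℕ) : ℕ := Y.cell l i y - Y.cellBase l i (Y.cell (l + 1) i y)

theorem cellBase_add_code (l i y : ℕ) :
    Y.cellBase l i (Y.cell (l + 1) i y) + Y.code l i y = Y.cell l i y :=
  Nat.add_sub_of_le (Nat.sInf_le ⟨y, rfl, rfl⟩)

theorem code_le_cell (l i y : ℕ) : Y.code l i y ≤ Y.cell l i y := Nat.sub_le _ _

theorem code_le {l : ℕ} (hl : l + 1 ≤ Y.k) (i y : ℕ) : Y.code l i y ≤ 2 * 2 ^ Y.β := by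
  obtain ⟨y', hy', h⟩ := Nat.sInf_mem (s := Y.cell l i '' {y' | Y.cell (l + 1) i y' =
    Y.cell (l + 1) i y}) ⟨_, y, rfl, rfl⟩
  have := Y.cell_le_add hl hy'
  rw [code, cellBase, ← h]
  omega

theorem code_congr {l i y y' : ℕ} (h : Y.cell l i y = Y.cell l i y')
    (h' : Y.cell (l + 1) i y = Y.cell (l + 1) i y') : Y.code l i y = Y.code l i y' := by
  rw [code, code, h, h']

/-- Above level `k` there is a single cell; from there the codes determine the cells downwards. -/
theorem cell_congr_of_code {j i y y' : ℕ}
    (h : ∀ l, j ≤ l → l ≤ Y.k → Y.code l i y = Y.code l i y') {l : ℕ} (hl : j ≤ l) :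
    Y.cell l i y = Y.cell l i y' := by
  obtain ⟨d, hd⟩ : ∃ d, Y.k + 1 ≤ l + d := ⟨Y.k + 1, by omega⟩
  induction d generalizing l with
  | zero => rw [Y.cell_top (by omega), Y.cell_top (by omega)]
  | succ d ih =>
    rcases lt_or_ge Y.k l with h1 | h1
    · rw [Y.cell_top (by omega), Y.cell_top (by omega)]
    · rw [← Y.cellBase_add_code l i y, ← Y.cellBase_add_code l i y', h l hl h1,
        ih (l := l + 1) (by omega) (by omega)]

/-- The binary logarithm of the weight of row `i`, rounded up. -/
noncomputable def logTotal (i : ℕ) : ℕ := Nat.clog 2 ⌈Y.total i⌉₊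

theorem total_le_two_pow (i : ℕ) : Y.total i ≤ 2 ^ Y.logTotal i := by
  refine (Nat.le_ceil _).trans ?_
  exact_mod_cast Nat.le_pow_clog (by norm_num) _

theorem logTotal_le {i s : ℕ} (h : Fintype.card V ≤ 2 ^ s) : Y.logTotal i ≤ s := by
  refine (Nat.clog_le_iff_le_pow (by norm_num)).2 (le_trans ?_ h)
  exact Nat.ceil_le.2 (Y.total_le_card i)

/-- One factor 2 comes from rounding up the logarithm, the other from rounding up a weight that is
at least 1. -/
theorem two_pow_logTotal_le {i : ℕ} (h : 1 ≤ Y.total i) : (2 : ℝ) ^ Y.logTotal i ≤ 4 * Y.total i := by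
  have h1 : 2 ^ Y.logTotal i ≤ 2 * ⌈Y.total i⌉₊ := by
    rcases Nat.eq_zero_or_pos (Y.logTotal i) with h0 | h0
    · rw [h0, pow_zero]
      have : 0 < ⌈Y.total i⌉₊ := Nat.ceil_pos.2 (by linarith)
      omega
    · have h2 : ¬ ⌈Y.total i⌉₊ ≤ 2 ^ (Y.logTotal i - 1) := by
        rw [← Nat.clog_le_iff_le_pow (by norm_num)]
        have : Nat.clog 2 ⌈Y.total i⌉₊ = Y.logTotal i := rfl
        omega
      obtain ⟨d, hd⟩ := Nat.exists_eq_succ_of_ne_zero h0.ne'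
      rw [hd, Nat.succ_eq_add_one] at h2 ⊢
      rw [pow_succ]
      simp only [Nat.add_sub_cancel] at h2
      omega
  have h2 := Nat.ceil_lt_add_one (by linarith : 0 ≤ Y.total i)
  have h3 : (2 : ℝ) ^ Y.logTotal i ≤ 2 * ⌈Y.total i⌉₊ := by exact_mod_cast h1
  linarith

theorem code_lt {l : ℕ} (hl : l ≤ Y.k) (i y : ℕ) :
    Y.code l i y < 2 ^ bits Y.β (Y.logTotal i) l := by
  have hL := Y.logTotal_le (i := i) Y.card_le
  have h1 : Y.code l i y * 2 ^ (l * Y.β) ≤ 2 * 2 ^ Y.logTotal i := by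
    have h1 := Y.cell_le l i y
    rw [le_div_iff₀ (by positivity)] at h1
    have h2 := Y.total_le_two_pow i
    have h3 : (Y.cell l i y : ℝ) * 2 ^ (l * Y.β) ≤ 2 * 2 ^ Y.logTotal i := by linarith
    exact (Nat.mul_le_mul_right _ (Y.code_le_cell l i y)).trans (by exact_mod_cast h3)
  have h2 : Y.code l i y * 2 ^ (l * Y.β) ≤ 2 * 2 ^ (Y.logTotal i - l * Y.β) * 2 ^ (l * Y.β) ∨
      Y.code l i y * 2 ^ (l * Y.β) ≤ 2 * 2 ^ (l * Y.β) := by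
    rcases le_total (l * Y.β) (Y.logTotal i) with h | h
    · left; rwa [mul_assoc, ← pow_add, Nat.sub_add_cancel h]
    · right; exact h1.trans (Nat.mul_le_mul_left _ (Nat.pow_le_pow_right (by norm_num) h))
  have h3 : Y.code l i y ≤ 2 * 2 ^ (Y.logTotal i - l * Y.β) := by
    rcases h2 with h2 | h2
    · exact Nat.le_of_mul_le_mul_right h2 (by positivity)
    · have := Nat.le_of_mul_le_mul_right h2 (by positivity)
      have : 1 ≤ 2 ^ (Y.logTotal i - l * Y.β) := Nat.one_le_two_pow
      omega
  have h4 : Y.code l i y ≤ 2 * 2 ^ min Y.β (Y.logTotal i - l * Y.β) := by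
    rcases Nat.lt_or_ge l Y.k with h | h
    · rcases le_total Y.β (Y.logTotal i - l * Y.β) with h' | h'
      · rw [min_eq_left h']; exact Y.code_le h i y
      · rwa [min_eq_right h']
    · obtain rfl : l = Y.k := by omega
      rwa [min_eq_right]
      rw [add_one_mul] at hL
      omega
  rw [bits, pow_add]
  have : 1 ≤ 2 ^ min Y.β (Y.logTotal i - l * Y.β) := Nat.one_le_two_pow
  omega

theorem code_lt' {l : ℕ} (hl : l ≤ Y.k) (i y : ℕ) : Y.code l i y < 2 ^ (Y.β + 2) :=
  (Y.code_lt hl i y).trans_le (Nat.pow_le_pow_right (by norm_num) (by simp [bits]))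

/-- A code depends on the cells of levels `l` and `l + 1` only, so it survives the step unless one
of these levels is updated. -/
theorem code_succ {l i : ℕ} (hl : l ≠ 0) (h : ¬ Y.k ∣ i + 1 + l)
    (h' : l + 1 ≤ Y.k → ¬ Y.k ∣ i + 1 + (l + 1)) (y : ℕ) :
    Y.code l (i + 1) y = Y.code l i y := by
  have h1 : ∀ y, Y.cell l (i + 1) y = Y.cell l i y := fun y => by
    rw [cell, cell, updateTime_succ hl h]
  have h2 : ∀ y, Y.cell (l + 1) (i + 1) y = Y.cell (l + 1) i y := fun y => by
    rcases Nat.lt_or_ge Y.k (l + 1) with h3 | h3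
    · rw [Y.cell_top h3, Y.cell_top h3]
    · rw [cell, cell, updateTime_succ (Nat.succ_ne_zero l) (h' h3)]
  simp only [code, cellBase, h1, h2]

end Layout

/-! ### Labels and their comparison -/

/-- The information from which adjacency is decided. -/
structure Label (t : ℕ) where
  (main k β logTotal logTotalNext level newCode newCode' : ℕ)
  slot : Fin (t + 1) → Fin 9 → ℕ

namespace Label

variable {t : ℕ}

/-- All parts of a label other than `main`. -/
def advice (D : Label t) : List ℕ :=
  [D.k, D.β, D.logTotal, D.logTotalNext, D.level, D.newCode, D.newCode'] ++
    List.ofFn fun p : Fin ((t + 1) * 9) => D.slot (finProdFinEquiv.symm p).1 (finProdFinEquiv.symm p).2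

/-- The bit string of a label. -/
def encode (D : Label t) : List Bool := encMessage D.advice D.main

theorem encode_injective : Function.Injective (encode (t := t)) := by
  intro D D' h
  obtain ⟨h1, h2⟩ := encMessage_inj h
  simp only [advice, List.cons_append, List.nil_append, List.cons.injEq] at h1
  obtain ⟨a1, a2, a3, a4, a5, a6, a7, h3⟩ := h1
  have h4 := List.ofFn_injective h3
  have h5 : D.slot = D'.slot := by
    funext s f
    simpa using congrFun h4 (finProdFinEquiv (s, f))
  cases D; cases D'
  simp_all

theorem length_encode_le (D : Label t) (s : ℕ)
    (h : D.k < 2 ^ s ∧ D.β < 2 ^ s ∧ D.logTotal < 2 ^ s ∧ D.logTotalNext < 2 ^ s ∧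
      D.level < 2 ^ s ∧ D.newCode < 2 ^ s ∧ D.newCode' < 2 ^ s) (hs : ∀ p f, D.slot p f < 2 ^ s) :
    D.encode.length ≤ D.main.size + 1 + (7 + (t + 1) * 9) * (2 * s + 2) := by
  have h1 : D.advice.length = 7 + (t + 1) * 9 := by simp [advice]; omega
  rw [← h1]
  refine length_encMessage_le _ _ s fun a ha => ?_
  simp only [advice, List.mem_append, List.mem_cons, List.mem_ofFn, List.not_mem_nil, or_false] at ha
  rcases ha with (rfl | rfl | rfl | rfl | rfl | rfl | rfl) | ⟨p, rfl⟩
  exacts [h.1, h.2.1, h.2.2.1, h.2.2.2.1, h.2.2.2.2.1, h.2.2.2.2.2.1, h.2.2.2.2.2.2, hs _ _]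

/-- The identifier, computed from the label of a point, of its `s`-th parent in the row of the
point. -/
def ident (D : Label t) (s : Fin (t + 1)) : ℕ × ℕ × (ℕ → ℕ) × ℕ × ℕ :=
  (D.main / 2 ^ offset (bits D.β D.logTotal) (D.k + 1) *
      2 ^ offset (bits D.β D.logTotal) (D.k + 1),
    D.slot s 0,
    fun l => if D.slot s 0 < l ∧ l ≤ D.k then digit (bits D.β D.logTotal) D.main l else 0,
    D.slot s 1, D.slot s 2)

/-- The identifier, computed from the label of a point, of its `s`-th parent in the row after that
of the point. -/
def identNext (D : Label t) (s : Fin (t + 1)) : ℕ × ℕ × (ℕ → ℕ) × ℕ × ℕ :=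
  (((D.ident s).1 / 2 ^ offset (bits D.β D.logTotalNext) (D.k + 1) + 1) *
      2 ^ offset (bits D.β D.logTotalNext) (D.k + 1),
    D.slot s 3,
    fun l => if D.slot s 3 < l ∧ l ≤ D.k then
      if l = D.level then D.newCode else if l + 1 = D.level then D.newCode' else
        digit (bits D.β D.logTotal) D.main l
      else 0,
    D.slot s 4, D.slot s 5)

/-- The label `D` says that its point is adjacent to that of `D'`. -/
def Recognizes (D D' : Label t) : Prop :=
  ∃ s, D.slot s 6 = 1 ∧ D.ident s = D'.ident 0 ∨ D.slot s 7 = 1 ∧ D.identNext s = D'.ident 0 ∨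
    D.slot s 8 = 1 ∧ D.ident s = D'.identNext 0

end Label

/-! ### Row numbers and column identifiers -/

namespace Layout

variable {V W : Type*} [Fintype V] {t : ℕ} (Y : Layout V W t)

/-- The row `i` or the one before it contains a point. -/
def Active (i : ℕ) : Prop := ∃ z, Y.row z = i ∨ Y.row z + 1 = i

/-- The number of bits of the codes of the points in row `i`. -/
noncomputable def width (i : ℕ) : ℕ := offset (bits Y.β (Y.logTotal i)) (Y.k + 1)

open Classical in
/-- A number that identifies the active row `i`. -/
noncomputable def start : ℕ → ℕ
  | 0 => 0
  | i + 1 => if Y.Active (i + 1) then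
      -- The next multiple after `start i` needs only `start i` and the new width, so a label in row
      -- `i` can compute it.
      (start i / 2 ^ Y.width (i + 1) + 1) * 2 ^ Y.width (i + 1) else start i

theorem two_pow_width_dvd_start {i : ℕ} (h : Y.Active i) : 2 ^ Y.width i ∣ Y.start i := by
  cases i with
  | zero => simp [start]
  | succ i => rw [start, if_pos h]; exact Nat.dvd_mul_left _ _

theorem start_lt_succ {i : ℕ} (h : Y.Active (i + 1)) : Y.start i < Y.start (i + 1) := by
  rw [start, if_pos h]
  rw [mul_comm]
  exact Nat.lt_mul_div_succ _ (by positivity)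

theorem start_mono : Monotone Y.start := by
  refine monotone_nat_of_le_succ fun i => ?_
  by_cases h : Y.Active (i + 1)
  · exact (Y.start_lt_succ h).le
  · rw [start, if_neg h]

theorem start_inj {i i' : ℕ} (hi : Y.Active i) (hi' : Y.Active i') (h : Y.start i = Y.start i') :
    i = i' := by
  have key : ∀ i i', Y.Active i' → i < i' → Y.start i < Y.start i' := fun i i' hi' h => by
    obtain ⟨d, rfl⟩ := Nat.exists_eq_add_of_lt h
    exact (Y.start_mono (Nat.le_add_right i d)).trans_lt (Y.start_lt_succ hi')
  rcases lt_trichotomy i i' with h1 | h1 | h1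
  · exact absurd h (key i i' hi' h1).ne
  · exact h1
  · exact absurd h (key i' i hi h1).ne'

theorem two_pow_width_le {i : ℕ} (h : Y.Active i) :
    (2 : ℝ) ^ Y.width i ≤ 4 ^ (Y.k + 2) * Y.total i := by
  obtain ⟨z, hz⟩ := h
  have h1 := Y.one_le_total hz
  calc (2 : ℝ) ^ Y.width i ≤ 2 ^ (Y.logTotal i + 2 * (Y.k + 1)) :=
        pow_le_pow_right₀ (by norm_num) (offset_bits_le _ _ _)
    _ = 4 ^ (Y.k + 1) * 2 ^ Y.logTotal i := by rw [pow_add, pow_mul]; norm_num; ring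
    _ ≤ 4 ^ (Y.k + 1) * (4 * Y.total i) := by gcongr; exact Y.two_pow_logTotal_le h1
    _ = 4 ^ (Y.k + 2) * Y.total i := by ring

theorem total_nonneg (i : ℕ) : 0 ≤ Y.total i := Finset.sum_nonneg fun _ _ => (decay_pos _ _ _).le

theorem start_le (i : ℕ) :
    (Y.start i : ℝ) ≤ ∑ j ∈ Finset.range (i + 1), 4 ^ (Y.k + 2) * Y.total j := by
  induction i with
  | zero =>
    simp only [start, Nat.cast_zero]
    exact Finset.sum_nonneg fun j _ => mul_nonneg (by positivity) (Y.total_nonneg j)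
  | succ i ih =>
    rw [Finset.sum_range_succ]
    by_cases h : Y.Active (i + 1)
    · have h1 := Y.two_pow_width_le h
      have h2 : Y.start (i + 1) ≤ Y.start i + 2 ^ Y.width (i + 1) := by
        rw [start, if_pos h, add_one_mul]
        exact Nat.add_le_add_right (Nat.div_mul_le_self _ _) _
      have h3 : (Y.start (i + 1) : ℝ) ≤ Y.start i + 2 ^ Y.width (i + 1) := by exact_mod_cast h2
      linarith
    · rw [start, if_neg h]
      have : 0 ≤ (4 : ℝ) ^ (Y.k + 2) * Y.total (i + 1) :=
        mul_nonneg (by positivity) (Y.total_nonneg _)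
      linarith

/-- The main part of the label of a point in row `i` and at position `y`. -/
noncomputable def main (i y : ℕ) : ℕ :=
  Y.start i + pack (bits Y.β (Y.logTotal i)) (fun l => Y.code l i y) (Y.k + 1)

theorem pack_lt_two_pow_width (i y : ℕ) :
    pack (bits Y.β (Y.logTotal i)) (fun l => Y.code l i y) (Y.k + 1) < 2 ^ Y.width i :=
  pack_lt fun _ hl => Y.code_lt (Nat.lt_succ_iff.1 hl) i y

/-- The blocks of all rows up to `i` and one more block for the codes have total length within twice
the sum of the `2 ^ width` bounds. -/
theorem main_lt {i : ℕ} (h : Y.Active i) (y : ℕ) :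
    Y.main i y < 4 ^ (Y.k + 2) * (8 * Y.k * Fintype.card V) := by
  have h1 : (Y.main i y : ℝ) < Y.start i + 2 ^ Y.width i := by
    exact_mod_cast Nat.add_lt_add_left (Y.pack_lt_two_pow_width i y) _
  have h2 := Y.start_le i
  have h3 := Y.two_pow_width_le h
  rw [← Finset.mul_sum] at h2
  have h4 := Y.sum_total_le (i + 1)
  have h5 : Y.total i ≤ ∑ j ∈ Finset.range (i + 1), Y.total j :=
    Finset.single_le_sum (fun j _ => Y.total_nonneg j) (Finset.self_mem_range_succ i)
  have h6 : (4 : ℝ) ^ (Y.k + 2) * (∑ j ∈ Finset.range (i + 1), Y.total j + Y.total i) ≤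
      4 ^ (Y.k + 2) * (8 * Y.k * Fintype.card V) := by gcongr; linarith
  rw [mul_add] at h6
  have h7 : (Y.main i y : ℝ) < 4 ^ (Y.k + 2) * (8 * Y.k * Fintype.card V) := by linarith
  exact_mod_cast h7

theorem main_div_mul {i : ℕ} (h : Y.Active i) (y : ℕ) :
    Y.main i y / 2 ^ Y.width i * 2 ^ Y.width i = Y.start i := by
  obtain ⟨ρ, hρ⟩ := Y.two_pow_width_dvd_start h
  rw [main, hρ, Nat.mul_add_div (by positivity), Nat.div_eq_of_lt (Y.pack_lt_two_pow_width i y),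
    add_zero, mul_comm]

theorem digit_main {i l : ℕ} (h : Y.Active i) (hl : l ≤ Y.k) (y : ℕ) :
    digit (bits Y.β (Y.logTotal i)) (Y.main i y) l = Y.code l i y := by
  obtain ⟨ρ, hρ⟩ := Y.two_pow_width_dvd_start h
  rw [main, hρ, add_comm, width, digit_add_mul (Nat.lt_succ_iff.2 hl),
    digit_pack (fun l hl => Y.code_lt (Nat.lt_succ_iff.1 hl) i y) (Nat.lt_succ_iff.2 hl)]

/-- The coarsest level at which the interval of `u` meets several cells of row `i`. -/
noncomputable def depth (i : ℕ) (u : W) : ℕ :=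
  Nat.findGreatest (fun j => Y.cell j i (Y.a u) < Y.cell j i (Y.b u + 1)) Y.k

/-- A point of the interval of `u` at which a cell of level `depth i u` ends. -/
noncomputable def cut (i : ℕ) (u : W) : ℕ :=
  sInf {y | Y.cell (Y.depth i u) i (Y.b u + 1) ≤ Y.cell (Y.depth i u) i (y + 1)}

/-- The identifier of the column `u` in the row `i`. -/
noncomputable def ident (i : ℕ) (u : W) : ℕ × ℕ × (ℕ → ℕ) × ℕ × ℕ :=
  (Y.start i, Y.depth i u,
    fun l => if Y.depth i u < l ∧ l ≤ Y.k then Y.code l i (Y.a u) else 0,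
    Y.code (Y.depth i u) i (Y.b u + 1), Y.rk (Y.cut i u) u)

/-- The interval of the column `u` contains a point of row `i` or of the row before. -/
def Live (i : ℕ) (u : W) : Prop :=
  u ∈ Set.range Y.col ∧ ∃ z, (Y.row z = i ∨ Y.row z + 1 = i) ∧
    Y.a u ≤ Y.pos (Y.col z) ∧ Y.pos (Y.col z) ≤ Y.b u

variable {Y}

theorem Live.active {i : ℕ} {u : W} (h : Y.Live i u) : Y.Active i := by
  obtain ⟨-, z, hz, -⟩ := h
  exact ⟨z, hz⟩

/-- Level 0 already separates the ends of a live interval, so the search defining `depth` does not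
fall back on its default value. -/
theorem Live.cell_lt {i : ℕ} {u : W} (h : Y.Live i u) :
    Y.cell (Y.depth i u) i (Y.a u) < Y.cell (Y.depth i u) i (Y.b u + 1) := by
  obtain ⟨-, z, hz, h1, h2⟩ := h
  refine Nat.findGreatest_spec (P := fun j => Y.cell j i (Y.a u) < Y.cell j i (Y.b u + 1))
    (m := 0) (Nat.zero_le _) ?_
  have h3 := Y.one_le_cumul_sub hz h1 (Nat.lt_succ_of_le h2)
  simp only [cell, Nat.zero_le, if_true, updateTime, zero_mul, pow_zero, div_one]
  refine Nat.lt_of_succ_le ((Nat.le_floor_iff (Y.cumul_nonneg _ _)).2 ?_)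
  have h4 := Nat.floor_le (Y.cumul_nonneg i (Y.a u))
  push_cast [Nat.succ_eq_add_one] at h3 ⊢
  linarith

theorem cell_eq_of_depth_lt {i l y : ℕ} {u : W} (hl : Y.depth i u < l) (h1 : Y.a u ≤ y)
    (h2 : y ≤ Y.b u + 1) : Y.cell l i y = Y.cell l i (Y.a u) := by
  rcases Nat.lt_or_ge Y.k l with h | h
  · rw [Y.cell_top h, Y.cell_top h]
  · have h3 := not_lt.1 (Nat.findGreatest_is_greatest
      (P := fun j => Y.cell j i (Y.a u) < Y.cell j i (Y.b u + 1)) hl h)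
    exact le_antisymm ((Y.cell_mono l i h2).trans h3) (Y.cell_mono l i h1)

theorem code_eq_of_depth_lt {i l y : ℕ} {u : W} (hl : Y.depth i u < l) (h1 : Y.a u ≤ y)
    (h2 : y ≤ Y.b u + 1) : Y.code l i y = Y.code l i (Y.a u) :=
  Y.code_congr (cell_eq_of_depth_lt hl h1 h2) (cell_eq_of_depth_lt (by omega) h1 h2)

theorem cut_le (i : ℕ) (u : W) : Y.cut i u ≤ Y.b u := Nat.sInf_le (le_refl (Y.cell _ i _))

theorem Live.le_cut {i : ℕ} {u : W} (h : Y.Live i u) : Y.a u ≤ Y.cut i u := by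
  by_contra hcon
  have h1 : Y.cell (Y.depth i u) i (Y.b u + 1) ≤ Y.cell (Y.depth i u) i (Y.cut i u + 1) :=
    Nat.sInf_mem (s := {y | Y.cell (Y.depth i u) i (Y.b u + 1) ≤ Y.cell (Y.depth i u) i (y + 1)})
      ⟨Y.b u, le_refl (Y.cell _ i _)⟩
  have h2 := Y.cell_mono (Y.depth i u) i (show Y.cut i u + 1 ≤ Y.a u by omega)
  exact absurd (h1.trans h2) (not_le.2 h.cell_lt)

/-- The codes above `depth` and the one at `depth` recover the cell of `b u + 1`. The cut is
determined by this cell and lies in both intervals, so equal ranks there force equal columns. -/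
theorem ident_inj {i i' : ℕ} {u u' : W} (h : Y.Live i u) (h' : Y.Live i' u')
    (he : Y.ident i u = Y.ident i' u') : i = i' ∧ u = u' := by
  simp only [ident, Prod.mk.injEq] at he
  obtain ⟨h1, h2, h3, h4, h5⟩ := he
  obtain rfl := Y.start_inj h.active h'.active h1
  refine ⟨rfl, ?_⟩
  have h6 : ∀ l, Y.depth i u + 1 ≤ l → Y.cell l i (Y.a u) = Y.cell l i (Y.a u') := by
    intro l hl
    refine Y.cell_congr_of_code (fun l hl hlk => ?_) hl
    have := congrFun h3 l
    rwa [if_pos ⟨hl, hlk⟩, if_pos ⟨by omega, hlk⟩] at this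
  have hab : Y.a u ≤ Y.b u + 1 := (h.le_cut.trans (cut_le i u)).trans (Nat.le_succ _)
  have hab' : Y.a u' ≤ Y.b u' + 1 := (h'.le_cut.trans (cut_le i u')).trans (Nat.le_succ _)
  have h7 : Y.cell (Y.depth i u) i (Y.b u + 1) = Y.cell (Y.depth i u') i (Y.b u' + 1) := by
    rw [← h2] at h4 ⊢
    rw [← Y.cellBase_add_code, ← Y.cellBase_add_code _ _ (Y.b u' + 1), h4,
      cell_eq_of_depth_lt (Nat.lt_succ_self _) hab le_rfl,
      cell_eq_of_depth_lt (u := u') (by omega) hab' le_rfl, h6 _ le_rfl]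
  have h8 : Y.cut i u = Y.cut i u' := by
    simp only [cut, h7]; rw [h2]
  rw [← h8] at h5
  exact Y.rk_inj _ u u' h.1 h'.1 h.le_cut (cut_le i u) (h8 ▸ h'.le_cut) (h8 ▸ cut_le i u') h5

theorem live_par {i : ℕ} {z : V} (h : Y.row z = i ∨ Y.row z + 1 = i) (s : Fin (t + 1)) :
    Y.Live i (Y.par (Y.col z) s) :=
  ⟨Y.par_mem z s, z, h, Y.le_pos z s, Y.pos_le z s⟩

theorem live_col {i : ℕ} {z : V} (h : Y.row z = i ∨ Y.row z + 1 = i) : Y.Live i (Y.col z) := by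
  have := live_par h 0
  rwa [Y.par_zero] at this

variable (Y)

/-! ### Correctness of the labels -/

/-- The level in `{1, …, k}` that is updated at row `i + 1`. -/
noncomputable def level (i : ℕ) : ℕ := Y.k - (i + 1) % Y.k

theorem level_le (i : ℕ) : Y.level i ≤ Y.k := Nat.sub_le _ _

theorem eq_level {i l : ℕ} (hl : l ≠ 0) (hlk : l ≤ Y.k) (h : Y.k ∣ i + 1 + l) : l = Y.level i := by
  have h1 := Nat.mod_lt (i + 1) Y.k_pos
  have h2 : Y.k ∣ (i + 1) % Y.k + l := by
    rw [← Nat.div_add_mod (i + 1) Y.k, add_assoc] at h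
    exact (Nat.dvd_add_right (Nat.dvd_mul_right _ _)).1 h
  obtain ⟨d, hd⟩ := h2
  have h3 : d = 1 := by
    have h4 : 0 < d := by
      rcases Nat.eq_zero_or_pos d with rfl | h; · omega
      exact h
    have h5 : d < 2 := by
      by_contra hcon
      have := Nat.mul_le_mul_left Y.k (not_lt.1 hcon)
      omega
    omega
  rw [h3, mul_one] at hd
  unfold level
  omega

open Classical in
/-- The label of the point `z` if the points are the vertices of the graph `G`. -/
noncomputable def label (G : SimpleGraph V) (z : V) : Label t where
  main := Y.main (Y.row z) (Y.pos (Y.col z))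
  k := Y.k
  β := Y.β
  logTotal := Y.logTotal (Y.row z)
  logTotalNext := Y.logTotal (Y.row z + 1)
  level := Y.level (Y.row z)
  newCode := Y.code (Y.level (Y.row z)) (Y.row z + 1) (Y.pos (Y.col z))
  newCode' := Y.code (Y.level (Y.row z) - 1) (Y.row z + 1) (Y.pos (Y.col z))
  slot s :=
    let u := Y.par (Y.col z) s
    ![Y.depth (Y.row z) u, Y.code (Y.depth (Y.row z) u) (Y.row z) (Y.b u + 1),
      Y.rk (Y.cut (Y.row z) u) u,
      Y.depth (Y.row z + 1) u, Y.code (Y.depth (Y.row z + 1) u) (Y.row z + 1) (Y.b u + 1),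
      Y.rk (Y.cut (Y.row z + 1) u) u,
      if ∃ z', G.Adj z z' ∧ Y.col z' = u ∧ Y.row z' = Y.row z then 1 else 0,
      if ∃ z', G.Adj z z' ∧ Y.col z' = u ∧ Y.row z' = Y.row z + 1 then 1 else 0,
      if ∃ z', G.Adj z z' ∧ Y.col z' = u ∧ Y.row z' + 1 = Y.row z then 1 else 0]

variable (G : SimpleGraph V)

theorem ident_label (z : V) (s : Fin (t + 1)) :
    (Y.label G z).ident s = Y.ident (Y.row z) (Y.par (Y.col z) s) := by
  have hact : Y.Active (Y.row z) := ⟨z, .inl rfl⟩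
  refine Prod.ext (Y.main_div_mul hact _) (Prod.ext rfl (Prod.ext ?_ rfl))
  funext l
  change (if Y.depth (Y.row z) _ < l ∧ l ≤ Y.k then
    digit (bits Y.β (Y.logTotal (Y.row z))) (Y.main (Y.row z) (Y.pos (Y.col z))) l else 0) =
    if Y.depth (Y.row z) _ < l ∧ l ≤ Y.k then _ else 0
  refine if_ctx_congr Iff.rfl (fun h => ?_) fun _ => rfl
  rw [Y.digit_main hact h.2]
  exact code_eq_of_depth_lt h.1 (Y.le_pos z s) ((Y.pos_le z s).trans (Nat.le_succ _))

/-- Only levels above `depth`, hence at least 1, are read. The updated level changes its own code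
and the code one level below, which is relative to it; all other codes are copied from row `i`. -/
theorem identNext_label (z : V) (s : Fin (t + 1)) :
    (Y.label G z).identNext s = Y.ident (Y.row z + 1) (Y.par (Y.col z) s) := by
  have hact : Y.Active (Y.row z) := ⟨z, .inl rfl⟩
  have hact' : Y.Active (Y.row z + 1) := ⟨z, .inr rfl⟩
  refine Prod.ext ?_ (Prod.ext rfl (Prod.ext ?_ rfl))
  · change (((Y.label G z).ident s).1 / 2 ^ Y.width (Y.row z + 1) + 1) *
      2 ^ Y.width (Y.row z + 1) = Y.start (Y.row z + 1)
    rw [ident_label, start, if_pos hact']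
    rfl
  · funext l
    change (if Y.depth (Y.row z + 1) _ < l ∧ l ≤ Y.k then
      if l = Y.level (Y.row z) then
        Y.code (Y.level (Y.row z)) (Y.row z + 1) (Y.pos (Y.col z)) else
      if l + 1 = Y.level (Y.row z) then
        Y.code (Y.level (Y.row z) - 1) (Y.row z + 1) (Y.pos (Y.col z)) else
      digit (bits Y.β (Y.logTotal (Y.row z))) (Y.main (Y.row z) (Y.pos (Y.col z))) l else 0) =
      if Y.depth (Y.row z + 1) _ < l ∧ l ≤ Y.k then _ else 0
    refine if_ctx_congr Iff.rfl (fun h => ?_) fun _ => rfl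
    rw [← code_eq_of_depth_lt h.1 (Y.le_pos z s) ((Y.pos_le z s).trans (Nat.le_succ _))]
    split_ifs with h1 h2
    · rw [h1]
    · rw [← h2, Nat.add_sub_cancel]
    · rw [Y.digit_main hact h.2]
      refine (Y.code_succ (by omega) (fun hd => h1 (Y.eq_level (by omega) h.2 hd))
        (fun hk hd => h2 (Y.eq_level (by omega) hk hd)) _).symm

theorem slot_six (z : V) (s : Fin (t + 1)) : (Y.label G z).slot s 6 = 1 ↔
    ∃ z', G.Adj z z' ∧ Y.col z' = Y.par (Y.col z) s ∧ Y.row z' = Y.row z := by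
  classical
  change (if _ then 1 else 0) = 1 ↔ _
  simp

theorem slot_seven (z : V) (s : Fin (t + 1)) : (Y.label G z).slot s 7 = 1 ↔
    ∃ z', G.Adj z z' ∧ Y.col z' = Y.par (Y.col z) s ∧ Y.row z' = Y.row z + 1 := by
  classical
  change (if _ then 1 else 0) = 1 ↔ _
  simp

theorem slot_eight (z : V) (s : Fin (t + 1)) : (Y.label G z).slot s 8 = 1 ↔
    ∃ z', G.Adj z z' ∧ Y.col z' = Y.par (Y.col z) s ∧ Y.row z' + 1 = Y.row z := by
  classical
  change (if _ then 1 else 0) = 1 ↔ _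
  simp

variable {Y G}

theorem adj_of_recognizes (hinj : ∀ z z', Y.row z = Y.row z' → Y.col z = Y.col z' → z = z')
    {z w : V} (h : (Y.label G z).Recognizes (Y.label G w)) : G.Adj z w := by
  obtain ⟨s, h⟩ := h
  rw [slot_six, slot_seven, slot_eight, ident_label, ident_label, identNext_label,
    identNext_label, Y.par_zero] at h
  rcases h with ⟨⟨z', hz, hc, hr⟩, he⟩ | ⟨⟨z', hz, hc, hr⟩, he⟩ | ⟨⟨z', hz, hc, hr⟩, he⟩
  · obtain ⟨h1, h2⟩ := ident_inj (live_par (.inl rfl) s) (live_col (.inl rfl)) he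
    rwa [← hinj z' w (by omega) (hc.trans h2)]
  · obtain ⟨h1, h2⟩ := ident_inj (live_par (.inr rfl) s) (live_col (.inl rfl)) he
    rwa [← hinj z' w (by omega) (hc.trans h2)]
  · obtain ⟨h1, h2⟩ := ident_inj (live_par (.inl rfl) s) (live_col (.inr rfl)) he
    rwa [← hinj z' w (by omega) (hc.trans h2)]

theorem recognizes_of_adj {z w : V} (h : G.Adj z w) {s : Fin (t + 1)}
    (hs : Y.par (Y.col z) s = Y.col w)
    (hr : Y.row w = Y.row z ∨ Y.row w = Y.row z + 1 ∨ Y.row w + 1 = Y.row z) :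
    (Y.label G z).Recognizes (Y.label G w) := by
  refine ⟨s, ?_⟩
  rw [slot_six, slot_seven, slot_eight, ident_label, ident_label, identNext_label,
    identNext_label, Y.par_zero, hs]
  rcases hr with hr | hr | hr
  · exact .inl ⟨⟨w, h, rfl, hr⟩, by rw [hr]⟩
  · exact .inr (.inl ⟨⟨w, h, rfl, hr⟩, by rw [hr]⟩)
  · exact .inr (.inr ⟨⟨w, h, rfl, hr⟩, by rw [hr]⟩)

theorem length_encode_label_le (z : V) {s : ℕ} (hk : Y.k < 2 ^ s) (hβ : Y.β + 2 ≤ s)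
    (hω : Y.ω ≤ 2 ^ s) (hL : (Y.k + 1) * Y.β < 2 ^ s) :
    (Y.label G z).encode.length ≤
      (Y.main (Y.row z) (Y.pos (Y.col z))).size + 1 + (7 + (t + 1) * 9) * (2 * s + 2) := by
  classical
  have hcode : ∀ l i y, l ≤ Y.k → Y.code l i y < 2 ^ s := fun l i y hl =>
    (Y.code_lt' hl i y).trans_le (Nat.pow_le_pow_right (by norm_num) hβ)
  have hdepth : ∀ i u, Y.depth i u ≤ Y.k := fun i u => Nat.findGreatest_le _
  have hrk : ∀ i s', (Y.row z = i ∨ Y.row z + 1 = i) →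
      Y.rk (Y.cut i (Y.par (Y.col z) s')) (Y.par (Y.col z) s') < 2 ^ s := fun i s' hi =>
    (Y.rk_lt _ _ (Y.par_mem z s') (live_par hi s').le_cut (cut_le _ _)).trans_le hω
  have hone : 1 < 2 ^ s := Nat.one_lt_two_pow (by omega)
  have hbit : ∀ p : Prop, ∀ [Decidable p], (if p then 1 else 0) < 2 ^ s := fun p _ => by
    split_ifs <;> omega
  refine Label.length_encode_le _ s ⟨hk, (show Y.β < s by omega).trans Nat.lt_two_pow_self,
    (Y.logTotal_le Y.card_le).trans_lt hL, (Y.logTotal_le Y.card_le).trans_lt hL,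
    (Y.level_le _).trans_lt hk, hcode _ _ _ (Y.level_le _),
    hcode _ _ _ ((Nat.sub_le _ _).trans (Y.level_le _))⟩ fun p f => ?_
  fin_cases f
  exacts [(hdepth _ _).trans_lt hk, hcode _ _ _ (hdepth _ _), hrk _ _ (.inl rfl),
    (hdepth _ _).trans_lt hk, hcode _ _ _ (hdepth _ _), hrk _ _ (.inr rfl), hbit _, hbit _, hbit _]

end Layout

/-! ### Choice of parameters and length of the labels -/

/-- A layout of an `n`-vertex subgraph of `H ⊠ P`, with about `√(log n)` levels. -/
theorem exists_layout {V W : Type*} [Fintype V] {t h : ℕ} {H : SimpleGraph W} (hH : IsTTree t H)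
    {G : SimpleGraph V} (φ : SimpleGraph.Copy G (strongProduct H (SimpleGraph.pathGraph h))) :
    ∃ Y : Layout V W t, Y.k = Nat.sqrt (Fintype.card V).size + 2 ∧
      Y.β = (Fintype.card V).size / (Nat.sqrt (Fintype.card V).size + 2) + 1 ∧
      Y.ω = (t + 1) * (Fintype.card V).size ∧
      (∀ z z', Y.row z = Y.row z' → Y.col z = Y.col z' → z = z') ∧
      ∀ z w, G.Adj z w →
        (Y.row w = Y.row z ∨ Y.row w = Y.row z + 1 ∨ Y.row w + 1 = Y.row z) ∧
        ((∃ s, Y.par (Y.col z) s = Y.col w) ∨ ∃ s, Y.par (Y.col w) s = Y.col z) := by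
  set n := Fintype.card V
  have hU : (Set.range fun z => (φ z).1).ncard < 2 ^ n.size := by
    refine lt_of_le_of_lt ?_ (Nat.lt_size_self n)
    rw [← Set.image_univ]
    refine (Set.ncard_image_le (Set.toFinite _)).trans ?_
    rw [Set.ncard_univ, Nat.card_eq_fintype_card]
  obtain ⟨a, b, pos, par, rk, h1, h2, h3, h4, h5⟩ := hH.exists_intervals _ _ hU
  refine ⟨{
    row := fun z => (φ z).2, col := fun z => (φ z).1, pos := pos, a := a, b := b, par := par
    rk := rk, k := Nat.sqrt n.size + 2, β := n.size / (Nat.sqrt n.size + 2) + 1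
    ω := (t + 1) * n.size, two_le := by omega
    card_le := ?_
    par_zero := h2
    par_mem := fun z s => (h1 _ ⟨z, rfl⟩ s).1
    le_pos := fun z s => (h1 _ ⟨z, rfl⟩ s).2.1
    pos_le := fun z s => (h1 _ ⟨z, rfl⟩ s).2.2
    rk_lt := h4, rk_inj := h5 }, rfl, rfl, rfl, ?_, ?_⟩
  · refine (Nat.lt_size_self n).le.trans (Nat.pow_le_pow_right (by norm_num) ?_)
    rw [add_one_mul]
    exact (Nat.lt_mul_div_succ _ (by omega)).le.trans (Nat.le_add_right _ _)
  · intro z z' hr hc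
    exact φ.injective (Prod.ext hc (Fin.ext hr))
  · intro z w hzw
    obtain ⟨-, hc, hr⟩ : (strongProduct H (SimpleGraph.pathGraph h)).Adj (φ z) (φ w) :=
      φ.toHom.map_adj hzw
    refine ⟨?_, ?_⟩
    · rcases hr with hr | hr
      · exact .inl (congrArg Fin.val hr.symm)
      · rw [SimpleGraph.pathGraph_adj] at hr
        rcases hr with hr | hr
        · exact .inr (.inl hr.symm)
        · exact .inr (.inr hr)
    · rcases hc with hc | hc
      · exact .inl ⟨0, (h2 _).trans hc⟩
      · exact h3 _ ⟨z, rfl⟩ _ ⟨w, rfl⟩ hc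

theorem size_le_of_lt {M e n : ℕ} (hn : 0 < n) (h : M < 2 ^ e * n) :
    (M.size : ℝ) ≤ Real.logb 2 n + e + 1 := by
  have hlog : 0 ≤ Real.logb 2 n := Real.logb_nonneg (by norm_num) (by exact_mod_cast hn)
  rcases Nat.eq_zero_or_pos M.size with h0 | h0
  · rw [h0, Nat.cast_zero]; positivity
  · have h1 : 2 ^ (M.size - 1) ≤ M := Nat.lt_size.1 (by omega)
    have h2 : ((2 : ℝ) ^ (M.size - 1)) ≤ 2 ^ e * n := by exact_mod_cast h1.trans h.le
    have h3 := Real.logb_le_logb_of_le (b := 2) (by norm_num) (by positivity) h2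
    have hn' : (n : ℝ) ≠ 0 := by positivity
    rw [Real.logb_mul (by positivity) hn', Real.logb_pow, Real.logb_pow,
      Real.logb_self_eq_one (by norm_num), Nat.cast_sub h0] at h3
    push_cast at h3
    linarith

/-- The constant of the second-order term of the length of the labels. -/
def lengthConst (t : ℕ) : ℕ := 16 + (16 + 9 * t) * (14 + 2 * t)

/-- The length of the labels. -/
noncomputable def labelLength (t n : ℕ) : ℝ :=
  Real.logb 2 n + lengthConst t * (Nat.sqrt n.size + 1)

theorem Layout.length_encode_label_le_labelLength {V W : Type*} [Fintype V] {t : ℕ}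
    (Y : Layout V W t) (G : SimpleGraph V)
    (hk : Y.k = Nat.sqrt (Fintype.card V).size + 2)
    (hβ : Y.β = (Fintype.card V).size / (Nat.sqrt (Fintype.card V).size + 2) + 1)
    (hω : Y.ω = (t + 1) * (Fintype.card V).size) (z : V) :
    ((Y.label G z).encode.length : ℝ) ≤ labelLength t (Fintype.card V) := by
  have hn : 0 < Fintype.card V := Fintype.card_pos_iff.2 ⟨z⟩
  set n := Fintype.card V with hn_def
  set r := Nat.sqrt n.size with hr_def
  have hσ : n.size < (r + 1) * (r + 1) := Nat.lt_succ_sqrt _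
  have hβr : Y.β ≤ r + 2 := by
    rw [hβ]
    have : n.size / (r + 2) < r + 2 := Nat.div_lt_of_lt_mul (by nlinarith)
    omega
  have hp : ∀ m : ℕ, m + 1 ≤ 2 ^ m := fun m => Nat.lt_two_pow_self
  -- Every entry of the advice fits in `2 * r + 6 + t` bits, which is `O(√(log n))` for fixed `t`.
  have h1 : (Y.k + 1) * Y.β < 2 ^ (2 * r + 6 + t) := by
    calc (Y.k + 1) * Y.β ≤ (r + 3) * (r + 2) := Nat.mul_le_mul (by omega) hβr
      _ ≤ 2 ^ (r + 2) * 2 ^ (r + 1) := Nat.mul_le_mul (hp _) (hp _)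
      _ = 2 ^ (2 * r + 3) := by rw [← pow_add]; congr 1; ring
      _ < 2 ^ (2 * r + 6 + t) := Nat.pow_lt_pow_right (by norm_num) (by omega)
  have h2 : Y.ω ≤ 2 ^ (2 * r + 6 + t) := by
    calc Y.ω ≤ (t + 1) * ((r + 1) * (r + 1)) := by rw [hω]; exact Nat.mul_le_mul_left _ hσ.le
      _ ≤ 2 ^ t * (2 ^ r * 2 ^ r) :=
        Nat.mul_le_mul (hp _) (Nat.mul_le_mul (hp _) (hp _))
      _ = 2 ^ (2 * r + t) := by rw [← pow_add, ← pow_add]; congr 1; ring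
      _ ≤ 2 ^ (2 * r + 6 + t) := Nat.pow_le_pow_right (by norm_num) (by omega)
  have h3 : Y.k < 2 ^ (2 * r + 6 + t) := by
    have := hp (2 * r + 6 + t)
    omega
  have h4 := Y.length_encode_label_le (G := G) z h3 (by omega) h2 h1
  have h5 : Y.main (Y.row z) (Y.pos (Y.col z)) < 2 ^ (3 * Y.k + 7) * n := by
    refine (Y.main_lt ⟨z, .inl rfl⟩ _).trans_le ?_
    calc 4 ^ (Y.k + 2) * (8 * Y.k * n) ≤ 4 ^ (Y.k + 2) * (8 * 2 ^ Y.k * n) := by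
          gcongr; exact Nat.lt_two_pow_self.le
      _ = 2 ^ (3 * Y.k + 7) * n := by
        rw [show (4 : ℕ) = 2 ^ 2 by norm_num, show (8 : ℕ) = 2 ^ 3 by norm_num, ← pow_mul]
        ring
  have h6 := size_le_of_lt hn h5
  have h7 : ((Y.label G z).encode.length : ℝ) ≤
      (Y.main (Y.row z) (Y.pos (Y.col z))).size + 1 +
        (7 + (t + 1) * 9) * (2 * (2 * r + 6 + t) + 2) := by exact_mod_cast h4
  rw [labelLength, lengthConst]
  push_cast [hk] at h6 ⊢
  have hr0 : (0 : ℝ) ≤ r := Nat.cast_nonneg _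
  have ht0 : (0 : ℝ) ≤ t := Nat.cast_nonneg _
  nlinarith [mul_nonneg hr0 ht0, mul_nonneg (mul_nonneg hr0 ht0) ht0]

theorem hasAdjacencyLabellingScheme_labelLength (t : ℕ) :
    HasAdjacencyLabellingScheme (productSubgraphs.{u} t) (labelLength t) := by
  classical
  -- The decoder need not know the layout: by injectivity of `encode` the strings determine the
  -- labels. Both directions are tried because either column may be the parent.
  refine ⟨fun s s' => decide (∃ D D' : Label t, D.encode = s ∧ D'.encode = s' ∧
    (D.Recognizes D' ∨ D'.Recognizes D)), ?_⟩
  rintro V _ G ⟨W, H, h, hH, ⟨φ⟩⟩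
  have := Fintype.ofFinite V
  obtain ⟨Y, hk, hβ, hω, hinj, hadj⟩ := exists_layout hH φ
  refine ⟨fun z => (Y.label G z).encode, fun z => ?_, fun z w => ?_⟩
  · rw [Nat.card_eq_fintype_card]
    exact Y.length_encode_label_le_labelLength G hk hβ hω z
  · rw [decide_eq_true_iff]
    constructor
    · rintro ⟨D, D', hD, hD', hrec⟩
      rw [Label.encode_injective hD, Label.encode_injective hD'] at hrec
      rcases hrec with hrec | hrec
      · exact Layout.adj_of_recognizes hinj hrec
      · exact (Layout.adj_of_recognizes hinj hrec).symm
    · intro hzw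
      refine ⟨_, _, rfl, rfl, ?_⟩
      obtain ⟨hr, ⟨s, hs⟩ | ⟨s, hs⟩⟩ := hadj z w hzw
      · exact .inl (Layout.recognizes_of_adj hzw hs hr)
      · exact .inr (Layout.recognizes_of_adj hzw.symm hs (by omega))

/-! ### Asymptotics and comparison with the stated error -/

theorem sqrt_size_add_one_le {n : ℕ} (hn : 2 ≤ n) :
    (Nat.sqrt n.size : ℝ) + 1 ≤ 3 * √(Real.logb 2 n) := by
  have h1 : 1 ≤ Real.logb 2 n := by
    rw [Real.le_logb_iff_rpow_le (by norm_num) (by positivity), Real.rpow_one]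
    exact_mod_cast hn
  have h2 : (n.size : ℝ) ≤ 4 * Real.logb 2 n := by
    have := size_le_of_lt (M := n) (e := 1) (n := n) (by omega) (by omega)
    push_cast at this
    linarith
  have h3 : (Nat.sqrt n.size : ℝ) ≤ 2 * √(Real.logb 2 n) := by
    refine Real.nat_sqrt_le_real_sqrt.trans (Real.sqrt_le_iff.2 ⟨by positivity, ?_⟩)
    rw [mul_pow, Real.sq_sqrt (by linarith)]
    linarith
  linarith [Real.one_le_sqrt.2 h1]

theorem abs_labelLength_sub_le {t n : ℕ} (hn : 2 ≤ n) :
    |labelLength t n - Real.logb 2 n| ≤ 3 * lengthConst t * √(Real.logb 2 n) := by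
  rw [labelLength, add_sub_cancel_left, abs_of_nonneg (by positivity)]
  have := mul_le_mul_of_nonneg_left (sqrt_size_add_one_le hn) (Nat.cast_nonneg (lengthConst t))
  linarith

theorem tendsto_logb_natCast : Tendsto (fun n : ℕ => Real.logb 2 n) atTop atTop :=
  (Real.tendsto_logb_atTop (by norm_num)).comp tendsto_natCast_atTop_atTop

theorem labelLength_isEquivalent (t : ℕ) :
    labelLength t ~[atTop] fun n : ℕ => Real.logb 2 n := by
  have h1 : (labelLength t - fun n : ℕ => Real.logb 2 n) =O[atTop]
      fun n : ℕ => √(Real.logb 2 n) := by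
    refine IsBigO.of_bound (3 * lengthConst t) ?_
    filter_upwards [eventually_ge_atTop 2] with n hn
    rw [Real.norm_eq_abs, Real.norm_of_nonneg (Real.sqrt_nonneg _)]
    exact abs_labelLength_sub_le hn
  refine h1.trans_isLittleO ?_
  have h2 : (fun x : ℝ => √x) =o[atTop] fun x : ℝ => x := by
    have h3 := (isLittleO_pow_pow_atTop_of_lt (𝕜 := ℝ) one_lt_two).comp_tendsto
      Real.tendsto_sqrt_atTop
    refine h3.congr' (.of_forall fun x => pow_one _) ?_
    filter_upwards [eventually_ge_atTop 0] with x hx using Real.sq_sqrt hx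
  exact h2.comp_tendsto tendsto_logb_natCast

/-- For `n ≤ 2` the iterated logarithm is 0, so the quotient is 0 by convention; for `n = 3` it is
at most 4. -/
theorem four_le_of_lt_logb_div {n : ℕ}
    (h : 16 < Real.logb 2 n / Real.logb 2 (Real.logb 2 n)) : 4 ≤ n := by
  by_contra hcon
  obtain rfl | rfl | rfl | rfl : n = 0 ∨ n = 1 ∨ n = 2 ∨ n = 3 := by omega
  · norm_num at h
  · norm_num at h
  · norm_num at h
  · have h1 : (3 / 2 : ℝ) ≤ Real.logb 2 (3 : ℕ) := by
      have := Real.logb_le_logb_of_le (b := 2) (by norm_num) (by norm_num)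
        (show (2 : ℝ) ^ 3 ≤ (3 : ℝ) ^ 2 by norm_num)
      rw [Real.logb_pow, Real.logb_pow, Real.logb_self_eq_one (by norm_num)] at this
      push_cast at this ⊢
      linarith
    have h2 : Real.logb 2 (3 : ℕ) ≤ 2 := by
      have := Real.logb_le_logb_of_le (b := 2) (by norm_num) (by norm_num)
        (show (3 : ℝ) ≤ (2 : ℝ) ^ 2 by norm_num)
      rw [Real.logb_pow, Real.logb_self_eq_one (by norm_num)] at this
      push_cast at this ⊢
      linarith
    generalize Real.logb 2 ((3 : ℕ) : ℝ) = q at h h1 h2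
    have h3 : (1 / 2 : ℝ) ≤ Real.logb 2 q := by
      have := Real.logb_le_logb_of_le (b := 2) (by norm_num) (by norm_num)
        (show (2 : ℝ) ≤ q ^ 2 by nlinarith)
      rw [Real.logb_pow, Real.logb_self_eq_one (by norm_num)] at this
      push_cast at this ⊢
      linarith
    rw [lt_div_iff₀ (by linarith)] at h
    linarith

theorem sqrt_logb_le {n k : ℕ} (hk : 5 ≤ k)
    (hk' : k ≤ ⌈√(Real.logb 2 n / Real.logb 2 (Real.logb 2 n))⌉₊) :
    2 ≤ n ∧ √(Real.logb 2 n) ≤ k * Real.logb 2 (Real.logb 2 n) + (k : ℝ)⁻¹ * Real.logb 2 n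
      + k * Real.logb 2 k := by
  have h1 : (4 : ℝ) < √(Real.logb 2 n / Real.logb 2 (Real.logb 2 n)) := by
    have := Nat.lt_ceil.1 (show 4 < _ from hk.trans hk')
    exact_mod_cast this
  have h2 := four_le_of_lt_logb_div (n := n) (by
    have := (Real.lt_sqrt (by norm_num)).1 h1
    norm_num at this; exact this)
  refine ⟨by omega, ?_⟩
  have h3 : 2 ≤ Real.logb 2 n := by
    rw [Real.le_logb_iff_rpow_le (by norm_num) (by positivity)]
    norm_num
    exact_mod_cast h2
  have h4 : 1 ≤ Real.logb 2 (Real.logb 2 n) := by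
    rw [Real.le_logb_iff_rpow_le (by norm_num) (by linarith), Real.rpow_one]
    exact h3
  have hk0 : (0 : ℝ) < k := by positivity
  have h5 : 0 ≤ (k : ℝ) * Real.logb 2 k :=
    mul_nonneg hk0.le (Real.logb_nonneg (by norm_num) (by exact_mod_cast (by omega : 1 ≤ k)))
  have h6 : (k : ℝ) ≤ k * Real.logb 2 (Real.logb 2 n) := le_mul_of_one_le_right hk0.le h4
  have h7 : √(Real.logb 2 n) ≤ k + (k : ℝ)⁻¹ * Real.logb 2 n := by
    have h8 := Real.sq_sqrt (show 0 ≤ Real.logb 2 n by linarith)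
    set q := √(Real.logb 2 n)
    -- Completing the square gives `q ≤ k + q ^ 2 / k`; the bare `k` is absorbed by `k * log log n`,
    -- as `log log n ≥ 1`.
    rw [← h8, ← sub_nonneg, show (k : ℝ) + (k : ℝ)⁻¹ * q ^ 2 - q =
      (k : ℝ)⁻¹ * ((k - q / 2) ^ 2 + 3 / 4 * q ^ 2) by field_simp; ring]
    positivity
  linarith

end AdjacencyLabelling

theorem mainTheorem3 (t : ℕ) :
    (∃ f : ℕ → ℝ,
      AdjacencyLabelling.HasAdjacencyLabellingScheme
        (AdjacencyLabelling.productSubgraphs.{u} t) f ∧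
      f ~[atTop] (fun n : ℕ => Real.logb 2 n)) ∧
    (∃ C : ℝ, 0 < C ∧ ∀ k : ℕ → ℕ, ∃ f : ℕ → ℝ,
      AdjacencyLabelling.HasAdjacencyLabellingScheme
        (AdjacencyLabelling.productSubgraphs.{u} t) f ∧
      ∀ n : ℕ, 5 ≤ k n →
        k n ≤ ⌈√(Real.logb 2 n / Real.logb 2 (Real.logb 2 n))⌉₊ →
        |f n - Real.logb 2 n| ≤
          C * (k n * Real.logb 2 (Real.logb 2 n) + (k n : ℝ)⁻¹ * Real.logb 2 n
            + k n * Real.logb 2 (k n))) := by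
  refine ⟨⟨_, AdjacencyLabelling.hasAdjacencyLabellingScheme_labelLength t,
    AdjacencyLabelling.labelLength_isEquivalent t⟩, 3 * AdjacencyLabelling.lengthConst t, ?_,
    fun k => ⟨_, AdjacencyLabelling.hasAdjacencyLabellingScheme_labelLength t, fun n hk hk' => ?_⟩⟩
  · have : 0 < AdjacencyLabelling.lengthConst t := by unfold AdjacencyLabelling.lengthConst; omega
    positivity
  · obtain ⟨hn, h⟩ := AdjacencyLabelling.sqrt_logb_le hk hk'
    exact (AdjacencyLabelling.abs_labelLength_sub_le hn).trans
      (mul_le_mul_of_nonneg_left h (by positivity))
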